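/- **Setting.** For a countable set $X$, $\mathrm{Disc}(X)$ denotes the probability distributions on $X$ and $\mathrm{SubDisc}(X)$ the sub-probability distributions; for $\gamma\in\mathrm{SubDisc}(X)$ put $\gamma(\bot)=1-\gamma(X)$. For a relation $\mathcal R\subseteq X\times Y$, write $\gamma_X\,\mathcal L(\mathcal R)\,\gamma_Y$ if there is $w\colon X\times Y\to[0,1]$ with $w(x,y)>0\Rightarrow x\,\mathcal R\,y$, $\sum_y w(x,y)=\gamma_X(x)$ and $\sum_x w(x,y)=\gamma_Y(y)$. A (finite) probabilistic automaton is $\mathcal A=(S,\bar s,\Sigma,D)$ with $S$ a finite set of states, $\bar s\in S$, $\Sigma=H\uplus\Sigma_e$ a set of hidden and external actions, and $D\subseteq S\times\Sigma\times\mathrm{Disc}(S)$ a finite set of transitions; $s\xrightarrow{a}\mu$ means $(s,a,\mu)\in D$, and $\tau$ ranges over hidden actions. A finite execution fragment is a sequence $\alpha=s_0a_1s_1\dots a_ns_n$ such that for each $i$ some $(s_{i-1},a_i,\mu_i)\in D$ has $\mu_i(s_i)>0$; its trace is its subsequence of external actions, and $\mathrm{trace}(a)$ is $a$ if $a\in\Sigma_e$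 and empty if $a\in H$. A scheduler $\sigma$ maps each finite execution fragment $\alpha$ to an element of $\mathrm{SubDisc}(D)$ supported on transitions leaving $\mathrm{last}(\alpha)$. With $s\in S$ it determines cone probabilities $\mu_{\sigma,s}(C_{t})=1$ if $t=s$ and $0$ if $t\ne s$ (for $t\in S$), $\mu_{\sigma,s}(C_{\alpha at})=\mu_{\sigma,s}(C_\alpha)\sum_{tr=(v,a,\rho)\in D}\sigma(\alpha)(tr)\,\rho(t)$, and $\mu_{\sigma,s}(\alpha)=\mu_{\sigma,s}(C_\alpha)\,\sigma(\alpha)(\bot)$. It induces the weak combined transition $s\xRightarrow{a}\mu$ if finite execution fragments have total probability $1$, $\mu_{\sigma,s}(\alpha)>0$ implies $\mathrm{trace}(\alpha)=\mathrm{trace}(a)$, and $\mu_{\sigma,s}(\{\alpha:\mathrm{last}(\alpha)=t\})=\mu(t)$ for all $t\in S$. For $A\subseteq D$, the transition is allowed respecting $A$ if moreover every $\sigma(\alpha)$ is supported in $A$. There is a hyper-transition $\rho\xRightarrow{a}\mu$ (allowed, respecting $A$) if there is a family of weak combined transitions $s\xRightarrow{a}\mu_s$ (allowed, respecting $A$),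 $s\in\mathrm{Supp}(\rho)$, with $\mu=\sum_{s\in\mathrm{Supp}(\rho)}\rho(s)\mu_s$. A scheduler $\sigma$ is said to induce it if such a family exists in which every member is induced by $\sigma$ (and, in the allowed case, every $\sigma(\alpha)$ is supported in $A$). **The LP problem** $LP(t,a,\mu,A,\mathcal R)$, for $t\in S$, $a\in\Sigma$, $\mu\in\mathrm{Disc}(S)$, $A\subseteq D$, $\mathcal R$ an equivalence relation on $S$. Let $(V,E)$ be the following directed graph. If $a$ is external, its vertices are $\vartriangle$, $\blacktriangledown$, $v$ and $v_a$ for $v\in S$, $v^{tr}$ and $v^{tr}_a$ for each $tr=(v,b,\rho)\in A$ with $b=a$ or $b$ hidden, and the classes $\mathcal C\in S/\mathcal R$. Its arcs are $(\vartriangle,t)$; $(v_a,\mathcal C)$ and $(\mathcal C,\blacktriangledown)$ for $v\in\mathcal C\in S/\mathcal R$; for each $tr=(v,\tau,\rho)\in A$ with $\tau$ hidden and each $v'\in\mathrm{Supp}(\rho)$, $(v,v^{tr})$, $(v^{tr},v')$, $(v_a,v^{tr}_a)$, $(v^{tr}_a,v'_a)$; and for each $tr=(v,a,\rho)\in A$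 and $v'\in\mathrm{Supp}(\rho)$, $(v,v^{tr}_a)$, $(v^{tr}_a,v'_a)$. If $a$ is hidden, all vertices with subscript $a$ and their arcs are omitted, and the arcs $(v_a,\mathcal C)$ are replaced by $(v,\mathcal C)$. The problem is to maximise $\sum_{(x,y)\in E}-f_{x,y}$ over real variables $(f_{x,y})_{(x,y)\in E}$ subject to: $f_{u,v}\ge0$ on all arcs; $f_{\vartriangle,t}=1$; $f_{\mathcal C,\blacktriangledown}=\mu(\mathcal C)$ for all $\mathcal C\in S/\mathcal R$; inflow equals outflow at each vertex other than $\vartriangle,\blacktriangledown$; and, for each transition and $v'$ as above, $f_{v^{tr},v'}=\rho(v')f_{v,v^{tr}}$ and (only if $a$ is external) $f_{v^{tr}_a,v'_a}=\rho(v')f_{v_a,v^{tr}_a}$ for hidden-labelled $tr=(v,\tau,\rho)\in A$, and $f_{v^{tr}_a,v'_a}=\rho(v')f_{v,v^{tr}_a}$ for $tr=(v,a,\rho)\in A$. "Has a solution" may be read either as "has a feasible point" or as "has an optimal point"; the statement holds for both readings. **Statement.** Let $\mathcal A$ be a finite probabilistic automaton, $t\in S$, $h\notin S$, $a\in\Sigma$,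 $\rho,\mu\in\mathrm{Disc}(S)$, $A\subseteq D$, and $\mathcal R$ an equivalence relation on $S$. For a hidden action $\tau$ put $A_h=A\cup\{h\xrightarrow{\tau}\rho\}$, $D_h=D\cup\{h\xrightarrow{\tau}\rho\}$, $\mathcal A_h=(S\cup\{h\},\bar s,\Sigma,D_h)$; regard distributions on $S$ as distributions on $S\cup\{h\}$ and let $\mathcal R_h=\mathcal R\cup\{(h,h)\}$. 1. $LP(t,a,\mu,D,\mathcal R)$ has a solution $f^*$ with $f^*_{\mathcal C,\blacktriangledown}=\mu(\mathcal C)$ for each $\mathcal C\in S/\mathcal R$ if and only if there exist $\mu_t\in\mathrm{Disc}(S)$ and a scheduler $\sigma$ for $\mathcal A$ inducing $t\xRightarrow{a}\mu_t$ such that $\mu\,\mathcal L(\mathcal R)\,\mu_t$. 2. For every hidden $\tau$, $LP(h,a,\mu,A_h,\mathcal R_h)$ relative to $\mathcal A_h$ has a solution $f^*$ with $f^*_{\mathcal C,\blacktriangledown}=\mu(\mathcal C)$ for each class $\mathcal C$ of $\mathcal R_h$ if and only if there exist $\mu_t\in\mathrm{Disc}(S)$ and a scheduler for $\mathcal A$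 inducing the allowed hyper-transition $\rho\xRightarrow{a}\mu_t$ respecting $A$ such that $\mu_t\,\mathcal L(\mathcal R)\,\mu$; equivalently, some allowed hyper-transition $\rho\xRightarrow{a}\mu_t$ respecting $A$ exists with $\mu_t\,\mathcal L(\mathcal R)\,\mu$. The same holds with $D_h$ in place of $A_h$ and ordinary hyper-transitions in place of allowed ones. 3. If $\mathcal I$ is the identity relation on $S$, then $\mu\,\mathcal L(\mathcal I)\,\mu_t$ implies $\mu_t=\mu$ for every $\mu_t\in\mathrm{Disc}(S)$. -/

import Mathlib

open scoped ENNReal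

noncomputable section

/-- Sub-probability distributions on `X`; `PMF X` is used for probability distributions. -/
def SubDisc (X : Type*) : Type _ := {f : X → ℝ≥0∞ // ∑' x, f x ≤ 1}

/-- The value at `⊥`, i.e. the missing mass `1 - γ(X)`. -/
def SubDisc.bot {X : Type*} (γ : SubDisc X) : ℝ≥0∞ := 1 - ∑' x, γ.1 x

/-- The support of a sub-probability distribution. -/
def SubDisc.supp {X : Type*} (γ : SubDisc X) : Set X := {x | 0 < γ.1 x}

/-- The lifting `L(R)` of a relation to distributions, by weighting functions into `[0,1]`. -/
def Lifting {X Y : Type*} (R : X → Y → Prop) (γX : PMF X) (γY : PMF Y) : Prop :=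
  ∃ w : X → Y → ℝ≥0∞,
    (∀ x y, w x y ≤ 1) ∧
    (∀ x y, 0 < w x y → R x y) ∧
    (∀ x, ∑' y, w x y = γX x) ∧
    (∀ y, ∑' x, w x y = γY y)

/-- A transition: source state, action label, target distribution. -/
structure Transition (S Act : Type*) where
  source : S
  action : Act
  target : PMF S

/-- Probabilistic automata with state space `S` (assumed finite where this is used), actions `Act`,
internal actions `hidden` (the other actions are external) and finitely many transitions. -/
structure ProbAut (S Act : Type*) where
  start : S
  hidden : Set Act
  trans : Set (Transition S Act)
  finite_trans : trans.Finite

/-- Alternating sequences `s₀ a₁ s₁ … aₙ sₙ`. -/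
inductive AltSeq (S Act : Type*) where
  | init (s : S) : AltSeq S Act
  | snoc (α : AltSeq S Act) (a : Act) (t : S) : AltSeq S Act

/-- The last state of an alternating sequence. -/
def AltSeq.last {S Act : Type*} : AltSeq S Act → S
  | .init s => s
  | .snoc _ _ t => t

namespace ProbAut

variable {S Act : Type*} (M : ProbAut S Act)

/-- The (finite) type of transitions of the automaton. -/
abbrev Tr : Type _ := {tr : Transition S Act // tr ∈ M.trans}

instance : Finite M.Tr := M.finite_trans.to_subtype

/-- The trace of a single action. -/
def traceOf (a : Act) : List Act :=
  open Classical in if a ∈ M.hidden then [] else [a]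

/-- The trace of a sequence: its subsequence of external actions. -/
def trace : AltSeq S Act → List Act
  | .init _ => []
  | .snoc α a _ => trace α ++ M.traceOf a

/-- The sequence is an execution fragment of `M`. -/
def IsFrag : AltSeq S Act → Prop
  | .init _ => True
  | .snoc α a t =>
      IsFrag α ∧ ∃ tr ∈ M.trans, tr.source = α.last ∧ tr.action = a ∧ 0 < tr.target t

/-- The finite execution fragments of `M`. -/
abbrev FinFrag : Type _ := {α : AltSeq S Act // M.IsFrag α}

/-- Schedulers: each finite execution fragment is mapped to a sub-probability distribution over
the transitions of `M` that leave its last state. -/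
structure Scheduler where
  choice : M.FinFrag → SubDisc M.Tr
  enabled : ∀ α, ∀ tr ∈ (choice α).supp, tr.1.source = α.1.last

variable {M}

/-- The probability of the cone of a finite execution fragment, for the scheduler `σ` started
in the state `s`. -/
def Scheduler.coneProb (σ : M.Scheduler) (s : S) : (α : AltSeq S Act) → M.IsFrag α → ℝ≥0∞
  | .init t, _ => open Classical in if t = s then 1 else 0
  | .snoc α a t, h =>
      σ.coneProb s α h.1 *
        ∑' tr : {tr : M.Tr // tr.1.action = a}, (σ.choice ⟨α, h.1⟩).1 tr.1 * tr.1.1.target t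

/-- The probability that exactly the finite execution fragment `α` is performed. -/
def Scheduler.fragProb (σ : M.Scheduler) (s : S) (α : M.FinFrag) : ℝ≥0∞ :=
  σ.coneProb s α.1 α.2 * (σ.choice α).bot

/-- The probability of a set of finite execution fragments. There are only countably many finite
execution fragments of non-zero probability, so this is the measure of `X` under the probabilistic
execution fragment generated by `σ` from `s`. -/
def Scheduler.prob (σ : M.Scheduler) (s : S) (X : Set M.FinFrag) : ℝ≥0∞ :=
  ∑' α : X, σ.fragProb s α.1

/-- The scheduler `σ` induces the weak combined transition from `s` to `μ` labelled by `a`. -/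
structure Scheduler.Induces (σ : M.Scheduler) (s : S) (a : Act) (μ : PMF S) : Prop where
  finite_prob : σ.prob s Set.univ = 1
  trace_eq : ∀ α : M.FinFrag, 0 < σ.fragProb s α → M.trace α.1 = M.traceOf a
  last_prob : ∀ t : S, σ.prob s {α | α.1.last = t} = μ t

/-- The scheduler only uses allowed transitions. -/
def Scheduler.Respects (σ : M.Scheduler) (A : Set (Transition S Act)) : Prop :=
  ∀ α, ∀ tr ∈ (σ.choice α).supp, tr.1 ∈ A

variable (M)

/-- Weak combined transitions. -/
def WeakCombined (s : S) (a : Act) (μ : PMF S) : Prop :=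
  ∃ σ : M.Scheduler, σ.Induces s a μ

/-- Allowed weak combined transitions. -/
def AllowedWeakCombined (A : Set (Transition S Act)) (s : S) (a : Act) (μ : PMF S) : Prop :=
  ∃ σ : M.Scheduler, σ.Induces s a μ ∧ σ.Respects A

/-- Hyper-transitions. -/
def Hyper (ρ : PMF S) (a : Act) (μ : PMF S) : Prop :=
  ∃ ν : ρ.support → PMF S, (∀ s : ρ.support, M.WeakCombined s a (ν s)) ∧
    ∀ t, μ t = ∑' s : ρ.support, ρ s * ν s t

/-- Allowed hyper-transitions. -/
def AllowedHyper (A : Set (Transition S Act)) (ρ : PMF S) (a : Act) (μ : PMF S) : Prop :=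
  ∃ ν : ρ.support → PMF S, (∀ s : ρ.support, M.AllowedWeakCombined A s a (ν s)) ∧
    ∀ t, μ t = ∑' s : ρ.support, ρ s * ν s t

variable {M}

/-- The single scheduler `σ` induces a hyper-transition from `ρ` to `μ` labelled by `a`. -/
def Scheduler.InducesHyper (σ : M.Scheduler) (ρ : PMF S) (a : Act) (μ : PMF S) : Prop :=
  ∃ ν : ρ.support → PMF S, (∀ s : ρ.support, σ.Induces s a (ν s)) ∧
    ∀ t, μ t = ∑' s : ρ.support, ρ s * ν s t

variable (M)

/-- The possible vertices of the network. -/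
inductive Vertex (R : Setoid S) where
  | source
  | sink
  | state (v : S)
  | tr (tr : M.Tr)
  | stateA (v : S)
  | trA (tr : M.Tr)
  | cls (C : Quotient R)

/-- The vertices present in the network: the copies with index `a` only if `a` is external. -/
def IsVertex (a : Act) (A : Set (Transition S Act)) (R : Setoid S) : M.Vertex R → Prop
  | .source => True
  | .sink => True
  | .state _ => True
  | .tr tr => tr.1 ∈ A ∧ (tr.1.action = a ∨ tr.1.action ∈ M.hidden)
  | .stateA _ => a ∉ M.hidden
  | .trA tr => a ∉ M.hidden ∧ tr.1 ∈ A ∧ (tr.1.action = a ∨ tr.1.action ∈ M.hidden)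
  | .cls _ => True

/-- The arcs of the network. -/
inductive Arc (t : S) (a : Act) (A : Set (Transition S Act)) (R : Setoid S) :
    M.Vertex R → M.Vertex R → Prop where
  | source : Arc t a A R .source (.state t)
  | sink (C : Quotient R) : Arc t a A R (.cls C) .sink
  | halt (v : S) : a ∈ M.hidden → Arc t a A R (.state v) (.cls (Quotient.mk R v))
  | haltA (v : S) : a ∉ M.hidden → Arc t a A R (.stateA v) (.cls (Quotient.mk R v))
  | intIn (tr : M.Tr) : tr.1 ∈ A → tr.1.action ∈ M.hidden →
      Arc t a A R (.state tr.1.source) (.tr tr)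
  | intOut (tr : M.Tr) (v' : S) : tr.1 ∈ A → tr.1.action ∈ M.hidden → v' ∈ tr.1.target.support →
      Arc t a A R (.tr tr) (.state v')
  | intInA (tr : M.Tr) : a ∉ M.hidden → tr.1 ∈ A → tr.1.action ∈ M.hidden →
      Arc t a A R (.stateA tr.1.source) (.trA tr)
  | intOutA (tr : M.Tr) (v' : S) : a ∉ M.hidden → tr.1 ∈ A → tr.1.action ∈ M.hidden →
      v' ∈ tr.1.target.support → Arc t a A R (.trA tr) (.stateA v')
  | extIn (tr : M.Tr) : a ∉ M.hidden → tr.1 ∈ A → tr.1.action = a →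
      Arc t a A R (.state tr.1.source) (.trA tr)
  | extOut (tr : M.Tr) (v' : S) : a ∉ M.hidden → tr.1 ∈ A → tr.1.action = a →
      v' ∈ tr.1.target.support → Arc t a A R (.trA tr) (.stateA v')

variable {M} in
/-- Vertices as a disjoint union. -/
def Vertex.toSum {R : Setoid S} :
    M.Vertex R → Bool ⊕ (S ⊕ M.Tr) ⊕ (S ⊕ M.Tr) ⊕ Quotient R
  | .source => .inl true
  | .sink => .inl false
  | .state v => .inr (.inl (.inl v))
  | .tr x => .inr (.inl (.inr x))
  | .stateA v => .inr (.inr (.inl (.inl v)))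
  | .trA x => .inr (.inr (.inl (.inr x)))
  | .cls C => .inr (.inr (.inr C))

theorem Vertex.toSum_injective {R : Setoid S} :
    Function.Injective (Vertex.toSum (M := M) (R := R)) := by
  intro x y h
  cases x <;> cases y <;> simp_all [Vertex.toSum]

instance [Finite S] (R : Setoid S) : Finite (M.Vertex R) :=
  Finite.of_injective _ (Vertex.toSum_injective M)

instance [Finite S] (R : Setoid S) : Fintype (M.Vertex R) := Fintype.ofFinite _

end ProbAut

/-- The probability `μ(C)` of an equivalence class, as a real number. -/
def classProb {S : Type*} (R : Setoid S) (μ : PMF S) (C : Quotient R) : ℝ :=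
  (∑' s : {s : S // Quotient.mk R s = C}, μ s).toReal

namespace ProbAut

variable {S Act : Type*} [Finite S] (M : ProbAut S Act)

/-- The constraints of the linear programming problem of `t`, `a`, `μ`, `A`, `R`. The variable of an
arc `(u, v)` is `f u v`; the values of `f` outside the arcs play no role. -/
structure LPFeasible (t : S) (a : Act) (μ : PMF S) (A : Set (Transition S Act)) (R : Setoid S)
    (f : M.Vertex R → M.Vertex R → ℝ) : Prop where
  nonneg : ∀ u v, M.Arc t a A R u v → 0 ≤ f u v
  source : f .source (.state t) = 1
  sink : ∀ C : Quotient R, f (.cls C) .sink = classProb R μ C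
  conservation : ∀ v, M.IsVertex a A R v → v ≠ .source → v ≠ .sink →
    open Classical in
    ∑ u with M.Arc t a A R u v, f u v - ∑ u with M.Arc t a A R v u, f v u = 0
  balance : ∀ tr : M.Tr, tr.1 ∈ A → tr.1.action ∈ M.hidden → ∀ v' ∈ tr.1.target.support,
    f (.tr tr) (.state v') - (tr.1.target v').toReal * f (.state tr.1.source) (.tr tr) = 0
  balanceA : a ∉ M.hidden →
    ∀ tr : M.Tr, tr.1 ∈ A → tr.1.action ∈ M.hidden → ∀ v' ∈ tr.1.target.support,
    f (.trA tr) (.stateA v') - (tr.1.target v').toReal * f (.stateA tr.1.source) (.trA tr) = 0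
  balanceExt : a ∉ M.hidden →
    ∀ tr : M.Tr, tr.1 ∈ A → tr.1.action = a → ∀ v' ∈ tr.1.target.support,
    f (.trA tr) (.stateA v') - (tr.1.target v').toReal * f (.state tr.1.source) (.trA tr) = 0

/-- The objective function, to be maximised. -/
def lpObjective (t : S) (a : Act) (A : Set (Transition S Act)) (R : Setoid S)
    (f : M.Vertex R → M.Vertex R → ℝ) : ℝ :=
  open Classical in
  ∑ e : M.Vertex R × M.Vertex R with M.Arc t a A R e.1 e.2, -f e.1 e.2

/-- Optimal solutions of the linear programming problem. -/
def LPOptimal (t : S) (a : Act) (μ : PMF S) (A : Set (Transition S Act)) (R : Setoid S)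
    (f : M.Vertex R → M.Vertex R → ℝ) : Prop :=
  M.LPFeasible t a μ A R f ∧
    ∀ g, M.LPFeasible t a μ A R g → M.lpObjective t a A R g ≤ M.lpObjective t a A R f

end ProbAut

/-! Adding a fresh state `h = none` to the state space: `S ∪ {h}` is `Option S`. -/

/-- A distribution on `S`, seen as a distribution on `S ∪ {h}`. -/
def extDist {S : Type*} (μ : PMF S) : PMF (Option S) := μ.map some

/-- A transition over `S`, seen as a transition over `S ∪ {h}`. -/
def Transition.ext {S Act : Type*} (tr : Transition S Act) : Transition (Option S) Act :=
  ⟨some tr.source, tr.action, extDist tr.target⟩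

/-- The transition from `h` to `ρ` labelled by `τ`. -/
def freshTransition {S Act : Type*} (τ : Act) (ρ : PMF S) : Transition (Option S) Act :=
  ⟨none, τ, extDist ρ⟩

/-- The set of transitions `A` together with the transition from `h` to `ρ` labelled by `τ`. -/
def extTrans {S Act : Type*} (A : Set (Transition S Act)) (τ : Act) (ρ : PMF S) :
    Set (Transition (Option S) Act) :=
  Transition.ext '' A ∪ {freshTransition τ ρ}

/-- The automaton `M` extended by `h` and the transition from `h` to `ρ` labelled by `τ`. -/
def ProbAut.extend {S Act : Type*} (M : ProbAut S Act) (τ : Act) (ρ : PMF S) :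
    ProbAut (Option S) Act where
  start := some M.start
  hidden := M.hidden
  trans := extTrans M.trans τ ρ
  finite_trans := (M.finite_trans.image _).union (Set.finite_singleton _)

/-- The equivalence relation `R ∪ {(h, h)}` on `S ∪ {h}`. -/
def extSetoid {S : Type*} (R : Setoid S) : Setoid (Option S) where
  r := Option.Rel R.r
  iseqv := by
    refine ⟨?_, ?_, ?_⟩
    · rintro (_ | x)
      · exact .none
      · exact .some (R.refl x)
    · rintro _ _ (h | _)
      · exact .some (R.symm h)
      · exact .none
    · rintro _ _ _ (h | _) (h' | _)
      · exact .some (R.trans h h')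
      · exact .none

end

/-! The common ground between schedulers and the linear program is a flow (`IsFlow`) on the network
whose nodes are pairs of a trace and a state. For hidden `a` only the trace `[]` occurs, for
external `a` also `[a]`; these are the one or two layers of state vertices in the LP graph. Using a
transition splits the flow in proportions fixed by its target distribution, which is what the
balance constraints say. Hence feasible points correspond to flows from the Dirac mass at `t` to
some halting distribution with the same class probabilities as `μ` (`exists_lpFeasible_iff`).
Equality of class probabilities is the same as lifting an equivalence relation
(`lifting_setoid_iff`).

From schedulers to flows (`Scheduler.Induces.exists_isFlow`): the natural candidate for the flow on
an edge is the expected number of its uses, but this may be infinite although the scheduler stops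
almost surely. The uses during the first `K` steps are finite, and they are a flow up to the mass
still running at time `K`, which tends to zero. The boundary values of flows form a finitely
generated cone; such cones are closed (`isClosed_finCone`), so the limiting boundary value is that
of a flow as well.

From flows to schedulers (`IsFlow.exists_scheduler`): choose the next transition with probability
proportional to the flow, depending only on the trace and the last state. A flow may contain
circulations that are never reached, so the expected number of visits to a node is only bounded by
the flow through it. This is enough: the expected length is finite, so the scheduler stops almost
surely; the mass stopped at each node is at most the prescribed one, and both families have total
one, so they agree. The same scheduler serves all starting states in the support of `ρ`.

For hyper-transitions, the fresh state `h` emits exactly one unit of flow along a hidden transition,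
which amounts to starting from `ρ` (`isFlow_extend_iff`). Both readings of "solution" agree because
the objective is minus the sum of nonnegative variables, so its superlevel sets are compact in the
arc variables (`LPFeasible.exists_optimal`). -/

noncomputable section

open scoped NNReal

/-! ### Finitely generated convex cones are closed. -/

section ConeClosed

variable {ι E : Type*} [AddCommGroup E] [Module ℝ E]

/-- The convex cone generated by finitely many vectors. -/
def finCone (s : Finset ι) (v : ι → E) : Set E :=
  {y | ∃ c : ι → ℝ, (∀ i ∈ s, 0 ≤ c i) ∧ ∑ i ∈ s, c i • v i = y}

/-- Carathéodory's reduction: subtracting a multiple of the dependency `g` does not change the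
vector. The smallest ratio `c i / g i` over positive `g i` is the largest multiple that keeps all
coefficients nonnegative, and it makes one of them vanish. -/
theorem finCone_subset_of_dependent [DecidableEq ι] (s : Finset ι) (v : ι → E)
    (g : ι → ℝ) (hg : ∑ i ∈ s, g i • v i = 0) (hpos : ∃ i ∈ s, 0 < g i) :
    finCone s v ⊆ ⋃ j ∈ s, finCone (s.erase j) v := by
  rintro y ⟨c, hc, rfl⟩
  obtain ⟨j, hj, hmin⟩ := (s.filter (fun i => 0 < g i)).exists_min_image (fun i => c i / g i)
    (by obtain ⟨i, hi, h⟩ := hpos; exact ⟨i, by simp [hi, h]⟩)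
  simp only [Finset.mem_filter] at hj hmin
  have hθ : 0 ≤ c j / g j := div_nonneg (hc j hj.1) hj.2.le
  have hd0 : c j - c j / g j * g j = 0 := by
    rw [div_mul_cancel₀ _ hj.2.ne', sub_self]
  simp only [Set.mem_iUnion]
  refine ⟨j, hj.1, fun i => c i - c j / g j * g i, fun i hi => ?_, ?_⟩
  · have hi' := Finset.mem_of_mem_erase hi
    rcases le_or_gt (g i) 0 with h | h
    · have := mul_nonpos_of_nonneg_of_nonpos hθ h
      have := hc i hi'
      linarith
    · have := (le_div_iff₀ h).1 (hmin i ⟨hi', h⟩)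
      linarith
  · have h1 : ∑ i ∈ s, (c i - c j / g j * g i) • v i = ∑ i ∈ s, c i • v i := by
      simp only [sub_smul, Finset.sum_sub_distrib, mul_smul, ← Finset.smul_sum, hg, smul_zero,
        sub_zero]
    rw [← h1, ← Finset.add_sum_erase s _ hj.1, hd0, zero_smul, zero_add]

theorem finCone_erase_subset [DecidableEq ι] (s : Finset ι) (v : ι → E) {j : ι} (hj : j ∈ s) :
    finCone (s.erase j) v ⊆ finCone s v := by
  rintro y ⟨c, hc, rfl⟩
  refine ⟨Function.update c j 0, fun i hi => ?_, ?_⟩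
  · by_cases h : i = j
    · simp [h]
    · simpa [h] using hc i (Finset.mem_erase.2 ⟨h, hi⟩)
  · rw [← Finset.add_sum_erase s _ hj]
    simp only [Function.update_self, zero_smul, zero_add]
    refine Finset.sum_congr rfl fun i hi => ?_
    rw [Function.update_of_ne (Finset.ne_of_mem_erase hi)]

/-- For dependent generators the cone is a finite union of cones on fewer generators, closed by
induction. For independent ones it is the image of a closed orthant under an injective linear map
out of a finite-dimensional space, which is a closed embedding. -/
theorem isClosed_finCone [TopologicalSpace E] [IsTopologicalAddGroup E] [ContinuousSMul ℝ E]
    [T2Space E] (s : Finset ι) (v : ι → E) : IsClosed (finCone s v) := by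
  classical
  induction s using Finset.strongInduction with
  | H s ih =>
    by_cases hdep : ∃ g : ι → ℝ, ∑ i ∈ s, g i • v i = 0 ∧ ∃ i ∈ s, g i ≠ 0
    · obtain ⟨g, hg, i, hi, hne⟩ := hdep
      have : finCone s v = ⋃ j ∈ s, finCone (s.erase j) v := by
        refine Set.Subset.antisymm ?_ (Set.iUnion₂_subset fun j hj => finCone_erase_subset s v hj)
        -- The reduction needs a positive coefficient; a dependency can be negated to provide one.
        rcases lt_or_gt_of_ne hne with h | h
        · exact finCone_subset_of_dependent s v (fun i => - g i) (by simp [hg])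
            ⟨i, hi, by simpa using h⟩
        · exact finCone_subset_of_dependent s v g hg ⟨i, hi, h⟩
      rw [this]
      exact s.finite_toSet.isClosed_biUnion fun j hj => ih _ (Finset.erase_ssubset hj)
    · let L : (s → ℝ) →ₗ[ℝ] E := Fintype.linearCombination ℝ (fun i : s => v i)
      have hL : LinearMap.ker L = ⊥ := by
        rw [LinearMap.ker_eq_bot']
        intro m hm
        by_contra hne
        obtain ⟨j, hj⟩ := Function.ne_iff.1 hne
        refine hdep ⟨fun i => if h : i ∈ s then m ⟨i, h⟩ else 0, ?_, j, j.2, by simpa using hj⟩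
        rw [← hm, ← Finset.sum_coe_sort]
        simp [L, Fintype.linearCombination_apply]
      have hcl : IsClosed {c : s → ℝ | ∀ i, 0 ≤ c i} := by
        simp only [Set.ofPred_forall]
        exact isClosed_iInter fun i => isClosed_le continuous_const (continuous_apply i)
      convert (LinearMap.isClosedEmbedding_of_injective hL).isClosedMap _ hcl using 1
      ext y
      constructor
      · rintro ⟨c, hc, rfl⟩
        refine ⟨fun i => c i, fun i => hc i i.2, ?_⟩
        simp only [L, Fintype.linearCombination_apply]
        exact Finset.sum_coe_sort s (fun i => c i • v i)
      · rintro ⟨c, hc, rfl⟩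
        refine ⟨fun i => if h : i ∈ s then c ⟨i, h⟩ else 0, fun i hi => by simpa [hi] using hc _, ?_⟩
        rw [← Finset.sum_coe_sort]
        simp [L, Fintype.linearCombination_apply]

end ConeClosed

/-! ### Cone weights of a scheduler and the evolution of mass in time. -/

namespace AltSeq

variable {S Act : Type*}

/-- The number of steps of an alternating sequence. -/
def len : AltSeq S Act → ℕ
  | .init _ => 0
  | .snoc α _ _ => len α + 1

/-- An alternating sequence is a state, or a shorter sequence with a further step. -/
def equivSum : AltSeq S Act ≃ S ⊕ (AltSeq S Act × Act × S) where
  toFun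
    | .init s => .inl s
    | .snoc α a t => .inr (α, a, t)
  invFun
    | .inl s => .init s
    | .inr p => .snoc p.1 p.2.1 p.2.2
  left_inv α := by cases α <;> rfl
  right_inv p := by rcases p with s | ⟨α, a, t⟩ <;> rfl

theorem tsum_eq (g : AltSeq S Act → ℝ≥0∞) :
    ∑' α, g α = ∑' s, g (.init s) + ∑' (α) (a) (t), g (.snoc α a t) := by
  rw [← equivSum.symm.tsum_eq g, Summable.tsum_sum ENNReal.summable ENNReal.summable]
  congr 1
  rw [ENNReal.tsum_prod']
  exact tsum_congr fun α => ENNReal.tsum_prod'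

end AltSeq

namespace ProbAut

variable {S Act : Type*} {M : ProbAut S Act}

namespace Scheduler

variable (σ : M.Scheduler)

/-- The choice of a scheduler, extended by zero to all alternating sequences. -/
def select (α : AltSeq S Act) (tr : M.Tr) : ℝ≥0∞ :=
  open Classical in if h : M.IsFrag α then (σ.choice ⟨α, h⟩).1 tr else 0

/-- The probability to end after an alternating sequence. -/
def stopProb (α : AltSeq S Act) : ℝ≥0∞ := 1 - ∑' tr, σ.select α tr

/-- The cone probabilities, for an arbitrary initial weight `ι`, on all alternating sequences. -/
def weight (ι : S → ℝ≥0∞) : AltSeq S Act → ℝ≥0∞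
  | .init t => ι t
  | .snoc α a t =>
      weight ι α * ∑' tr : M.Tr, open Classical in
        if tr.1.action = a then σ.select α tr * tr.1.target t else 0

/-- The expected value of `g` after the next step. -/
def next (g : AltSeq S Act → ℝ≥0∞) (α : AltSeq S Act) : ℝ≥0∞ :=
  ∑' tr : M.Tr, σ.select α tr * ∑' t, tr.1.target t * g (.snoc α tr.1.action t)

/-- The expected value of `g` after `k` steps. -/
def level (ι : S → ℝ≥0∞) (k : ℕ) (g : AltSeq S Act → ℝ≥0∞) : ℝ≥0∞ :=
  ∑' α, if α.len = k then σ.weight ι α * g α else 0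

theorem tsum_select_le (α : AltSeq S Act) : ∑' tr, σ.select α tr ≤ 1 := by
  unfold select
  split_ifs
  · exact (σ.choice _).2
  · simp

theorem tsum_select_add_stopProb (α : AltSeq S Act) : ∑' tr, σ.select α tr + σ.stopProb α = 1 :=
  add_tsub_cancel_of_le (σ.tsum_select_le α)

theorem source_of_select_ne_zero {α : AltSeq S Act} {tr : M.Tr} (h : σ.select α tr ≠ 0) :
    tr.1.source = α.last := by
  unfold select at h
  split_ifs at h with hα
  · exact σ.enabled ⟨α, hα⟩ tr (pos_iff_ne_zero.2 h)
  · exact absurd rfl h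

theorem tsum_action_eq_tsum_ite (a : Act) (g : M.Tr → ℝ≥0∞) :
    ∑' tr : {tr : M.Tr // tr.1.action = a}, g tr.1 =
      ∑' tr : M.Tr, open Classical in if tr.1.action = a then g tr else 0 := by
  classical
  rw [show (∑' tr : {tr : M.Tr // tr.1.action = a}, g tr.1)
    = ∑' tr : ({tr | tr.1.action = a} : Set M.Tr), g tr.1 from rfl, tsum_subtype]
  exact tsum_congr fun tr => by simp [Set.indicator_apply]

-- Passes from cone probabilities, which carry a proof of being a fragment, to a total function that
-- is linear in the initial weight.
open Classical in
theorem coneProb_eq_weight (s : S) (α : AltSeq S Act) (h : M.IsFrag α) :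
    σ.coneProb s α h = σ.weight (fun t => if t = s then 1 else 0) α := by
  induction α with
  | init t => simp [coneProb, weight]
  | snoc α a t ih =>
    simp only [coneProb, weight, ih h.1]
    rw [tsum_action_eq_tsum_ite a (fun tr => (σ.choice ⟨α, h.1⟩).1 tr * tr.1.target t)]
    simp [select, h.1]

/-- Allows sums over fragments to be taken over all alternating sequences. -/
theorem weight_eq_zero_of_not_isFrag (ι : S → ℝ≥0∞) (α : AltSeq S Act) (h : ¬ M.IsFrag α) :
    σ.weight ι α = 0 := by
  induction α with
  | init t => exact absurd trivial h
  | snoc α a t ih =>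
    by_cases hα : M.IsFrag α
    · rw [weight, ENNReal.tsum_eq_zero.2, mul_zero]
      intro tr
      split_ifs with ha
      · by_contra hne
        have hne' := mul_ne_zero_iff.1 hne
        exact h ⟨hα, tr.1, tr.2, σ.source_of_select_ne_zero hne'.1, ha, pos_iff_ne_zero.2 hne'.2⟩
      · rfl
    · rw [weight, ih hα, zero_mul]

open Classical in
theorem fragProb_eq (s : S) (α : M.FinFrag) :
    σ.fragProb s α = σ.weight (fun t => if t = s then 1 else 0) α.1 * σ.stopProb α.1 := by
  rw [fragProb, coneProb_eq_weight]
  simp [stopProb, select, SubDisc.bot, α.2]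

open Classical in
theorem prob_eq (s : S) (p : AltSeq S Act → Prop) [DecidablePred p] :
    σ.prob s {α | p α.1} =
      ∑' α, if p α then σ.weight (fun t => if t = s then 1 else 0) α * σ.stopProb α else 0 := by
  classical
  rw [prob, tsum_subtype {α : M.FinFrag | p α.1} (fun α => σ.fragProb s α)]
  have : ∀ α : M.FinFrag, ({α : M.FinFrag | p α.1}).indicator (fun α => σ.fragProb s α) α =
      (fun α : AltSeq S Act => if p α then
        σ.weight (fun t => if t = s then 1 else 0) α * σ.stopProb α else 0) α.1 := by
    intro α
    simp [Set.indicator_apply, fragProb_eq]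
  rw [tsum_congr this]
  refine (tsum_subtype {α | M.IsFrag α} (fun α : AltSeq S Act => if p α then
        σ.weight (fun t => if t = s then 1 else 0) α * σ.stopProb α else 0)).trans ?_
  refine tsum_congr fun α => Set.indicator_apply_eq_self.2 fun hf => ?_
  rw [σ.weight_eq_zero_of_not_isFrag _ α hf, zero_mul, ite_self]

open Classical in
theorem prob_univ_eq (s : S) :
    σ.prob s Set.univ = ∑' α, σ.weight (fun t => if t = s then 1 else 0) α * σ.stopProb α := by
  classical
  have := σ.prob_eq s (fun _ => True)
  simpa using this

-- By linearity in the initial weight, a run from a distribution splits into runs from single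
-- states.
open Classical in
theorem weight_eq_tsum (ρ : S → ℝ≥0∞) (α : AltSeq S Act) :
    σ.weight ρ α = ∑' s, ρ s * σ.weight (fun t => if t = s then 1 else 0) α := by
  induction α with
  | init t => simp [weight]
  | snoc α a t ih => simp only [weight, ← mul_assoc, ENNReal.tsum_mul_right, ← ih]

theorem tsum_weight_snoc (ι : S → ℝ≥0∞) (g : AltSeq S Act → ℝ≥0∞) (α : AltSeq S Act) :
    ∑' (a) (t), σ.weight ι (.snoc α a t) * g (.snoc α a t) = σ.weight ι α * σ.next g α := by
  classical
  simp only [weight, next, mul_assoc, ENNReal.tsum_mul_left]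
  congr 1
  simp only [← ENNReal.tsum_mul_right]
  calc _ = ∑' (a) (tr : M.Tr) (t), (if tr.1.action = a then σ.select α tr * tr.1.target t else 0) *
            g (.snoc α a t) := tsum_congr fun a => ENNReal.tsum_comm
    _ = ∑' (tr : M.Tr) (a) (t), (if tr.1.action = a then σ.select α tr * tr.1.target t else 0) *
            g (.snoc α a t) := ENNReal.tsum_comm
    _ = _ := by
      refine tsum_congr fun tr => ?_
      rw [tsum_eq_single tr.1.action]
      · simp [mul_assoc, ENNReal.tsum_mul_left]
      · intro a ha
        simp [ha.symm]

theorem tsum_weight_mul (ι : S → ℝ≥0∞) (g : AltSeq S Act → ℝ≥0∞) :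
    ∑' α, σ.weight ι α * g α =
      ∑' s, ι s * g (.init s) + ∑' α, σ.weight ι α * σ.next g α := by
  rw [AltSeq.tsum_eq]
  simp only [tsum_weight_snoc]
  rfl

theorem level_zero (ι : S → ℝ≥0∞) (g : AltSeq S Act → ℝ≥0∞) :
    σ.level ι 0 g = ∑' s, ι s * g (.init s) := by
  rw [level, AltSeq.tsum_eq]
  simp [AltSeq.len, weight]

theorem level_succ (ι : S → ℝ≥0∞) (k : ℕ) (g : AltSeq S Act → ℝ≥0∞) :
    σ.level ι (k + 1) g = σ.level ι k (σ.next g) := by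
  rw [level, AltSeq.tsum_eq]
  simp only [AltSeq.len, level, Nat.add_right_cancel_iff, (Nat.succ_ne_zero k).symm, if_false, tsum_zero, zero_add]
  refine tsum_congr fun α => ?_
  split_ifs
  · exact σ.tsum_weight_snoc ι g α
  · simp

theorem tsum_weight_eq_tsum_level (ι : S → ℝ≥0∞) (g : AltSeq S Act → ℝ≥0∞) :
    ∑' α, σ.weight ι α * g α = ∑' k, σ.level ι k g := by
  simp only [level]
  rw [ENNReal.tsum_comm]
  refine tsum_congr fun α => ?_
  simp

theorem level_add (ι : S → ℝ≥0∞) (k : ℕ) (g g' : AltSeq S Act → ℝ≥0∞) :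
    σ.level ι k (fun α => g α + g' α) = σ.level ι k g + σ.level ι k g' := by
  rw [level, level, level, ← ENNReal.tsum_add]
  refine tsum_congr fun α => ?_
  split_ifs
  · exact mul_add _ _ _
  · simp

theorem level_mono (ι : S → ℝ≥0∞) (k : ℕ) {g g' : AltSeq S Act → ℝ≥0∞} (h : ∀ α, g α ≤ g' α) :
    σ.level ι k g ≤ σ.level ι k g' := by
  refine ENNReal.tsum_le_tsum fun α => ?_
  split_ifs
  · gcongr
    exact h α
  · exact le_rfl

theorem level_mul_right (ι : S → ℝ≥0∞) (k : ℕ) (g : AltSeq S Act → ℝ≥0∞) (c : ℝ≥0∞) :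
    σ.level ι k (fun α => g α * c) = σ.level ι k g * c := by
  simp only [level, ← ENNReal.tsum_mul_right]
  refine tsum_congr fun α => ?_
  split_ifs
  · exact (mul_assoc _ _ _).symm
  · simp

theorem next_one (α : AltSeq S Act) : σ.next (fun _ => 1) α = ∑' tr, σ.select α tr := by
  simp [next, PMF.tsum_coe]

theorem level_one_add_level_stopProb (ι : S → ℝ≥0∞) (k : ℕ) :
    σ.level ι (k + 1) (fun _ => 1) + σ.level ι k σ.stopProb = σ.level ι k (fun _ => 1) := by
  rw [level_succ, ← level_add]
  congr 1
  ext α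
  rw [next_one, tsum_select_add_stopProb]

/-- Conservation of mass, by telescoping: what is still running at time `k` is what has not stopped
at an earlier time. -/
theorem level_one_add_sum_level_stopProb (ι : S → ℝ≥0∞) (k : ℕ) :
    σ.level ι k (fun _ => 1) + ∑ j ∈ Finset.range k, σ.level ι j σ.stopProb = ∑' s, ι s := by
  induction k with
  | zero => simp [level_zero]
  | succ k ih =>
    rw [Finset.sum_range_succ, add_comm (∑ j ∈ Finset.range k, _), ← add_assoc,
      level_one_add_level_stopProb, ih]

end Scheduler

end ProbAut

/-! ### Flows on the network of traces and states, and the truncated flow of a scheduler. -/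

namespace ProbAut

section Flow

variable {S Act : Type*} (M : ProbAut S Act)

/-- The traces that may occur during a weak transition labelled by `a`. -/
def phases (a : Act) : Finset (List Act) :=
  open Classical in {[], M.traceOf a}

/-- The pairs of a trace and a transition that may be used by a weak transition labelled by `a`. -/
def edges (a : Act) (A : Finset (Transition S Act)) : Finset (List Act × Transition S Act) :=
  M.phases a ×ˢ A

/-- `x` is a flow from `init` to `halt`, along the transitions in `A`, in the network whose nodes
are pairs of a trace and a state. -/
def IsFlow (a : Act) (A : Finset (Transition S Act)) (init halt : S → ℝ≥0)
    (x : List Act × Transition S Act → ℝ≥0) : Prop :=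
  open Classical in
  ∀ (l : List Act) (v : S),
    (if l = [] then init v else 0) +
      ∑ e ∈ M.edges a A,
        (if e.1 ++ M.traceOf e.2.action = l then x e * (e.2.target v).toNNReal else 0) =
    ∑ e ∈ M.edges a A, (if e.1 = l ∧ e.2.source = v then x e else 0) +
      (if l = M.traceOf a then halt v else 0)

theorem nil_mem_phases (a : Act) : [] ∈ M.phases a := by simp [phases]

theorem traceOf_mem_phases (a : Act) : M.traceOf a ∈ M.phases a := by simp [phases]

theorem mem_phases_iff_prefix {a : Act} {l : List Act} : l ∈ M.phases a ↔ l <+: M.traceOf a := by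
  unfold phases traceOf
  split_ifs <;> simp [List.prefix_cons_iff]

theorem phases_of_mem_hidden {a : Act} (ha : a ∈ M.hidden) : M.phases a = {[]} := by
  simp [phases, traceOf, ha]

end Flow

namespace Scheduler

variable {S Act : Type*} {M : ProbAut S Act} (σ : M.Scheduler)

/-- The indicator function of the sequences with trace `l` and last state `v`. -/
def atNode (M : ProbAut S Act) (l : List Act) (v : S) (α : AltSeq S Act) : ℝ≥0∞ :=
  open Classical in if M.trace α = l ∧ α.last = v then 1 else 0

/-- The probability that the trace is `e.1` and the transition `e.2` is chosen. -/
def edge (e : List Act × Transition S Act) (α : AltSeq S Act) : ℝ≥0∞ :=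
  open Classical in
  if M.trace α = e.1 then (if h : e.2 ∈ M.trans then σ.select α ⟨e.2, h⟩ else 0) else 0

/-- From the initial weight `ι`, the scheduler uses only the edges in `E`. -/
def UsesOnly (ι : S → ℝ≥0∞) (E : Finset (List Act × Transition S Act)) : Prop :=
  ∀ α tr, σ.weight ι α ≠ 0 → σ.select α tr ≠ 0 → (M.trace α, tr.1) ∈ E

variable {σ}

/-- Only edges at the current trace contribute, so the sum over transitions becomes a sum over an
index set that no longer depends on `α`. It can then be interchanged with `level`. -/
theorem UsesOnly.tsum_select {ι : S → ℝ≥0∞} {E : Finset (List Act × Transition S Act)}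
    (h : σ.UsesOnly ι E) {α : AltSeq S Act} (hα : σ.weight ι α ≠ 0)
    (G : List Act × Transition S Act → ℝ≥0∞) :
    ∑' tr : M.Tr, σ.select α tr * G (M.trace α, tr.1) = ∑ e ∈ E, σ.edge e α * G e := by
  classical
  have hsupp : ∀ e ∉ E, σ.edge e α * G e = 0 := by
    intro e he
    by_contra hne
    have hne := (mul_ne_zero_iff.1 hne).1
    unfold edge at hne
    split_ifs at hne with h1 h2
    · have := h α _ hα hne
      rw [h1] at this
      exact he this
    · exact hne rfl
    · exact hne rfl
  rw [← tsum_eq_sum (L := SummationFilter.unconditional _) hsupp, ENNReal.tsum_prod', tsum_eq_single (M.trace α)]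
  · have := tsum_subtype M.trans
      (fun tr => σ.edge (M.trace α, tr) α * G (M.trace α, tr))
    refine Eq.trans ?_ (this.trans ?_)
    · refine tsum_congr fun tr => ?_
      simp [edge, tr.2]
    · refine tsum_congr fun tr => Set.indicator_apply_eq_self.2 fun htr => ?_
      simp [edge, htr]
  · intro l hl
    simp [edge, hl.symm]

theorem level_congr {ι : S → ℝ≥0∞} {k : ℕ} {g g' : AltSeq S Act → ℝ≥0∞}
    (h : ∀ α, σ.weight ι α ≠ 0 → g α = g' α) : σ.level ι k g = σ.level ι k g' := by
  refine tsum_congr fun α => ?_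
  split_ifs
  · by_cases hα : σ.weight ι α = 0
    · simp [hα]
    · rw [h α hα]
  · rfl

theorem level_sum {β : Type*} (ι : S → ℝ≥0∞) (k : ℕ) (E : Finset β)
    (g : β → AltSeq S Act → ℝ≥0∞) :
    σ.level ι k (fun α => ∑ b ∈ E, g b α) = ∑ b ∈ E, σ.level ι k (g b) := by
  simp only [level]
  rw [← Summable.tsum_finsetSum fun _ _ => ENNReal.summable]
  refine tsum_congr fun α => ?_
  split_ifs
  · exact Finset.mul_sum _ _ _
  · simp

theorem next_atNode (l : List Act) (v : S) (α : AltSeq S Act) :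
    σ.next (atNode M l v) α = ∑' tr : M.Tr, σ.select α tr *
      (open Classical in if M.trace α ++ M.traceOf tr.1.action = l then tr.1.target v else 0) := by
  classical
  refine tsum_congr fun tr => ?_
  congr 1
  split_ifs with h
  · rw [tsum_eq_single v]
    · simp [atNode, trace, AltSeq.last, h]
    · intro w hw
      simp [atNode, AltSeq.last, hw]
  · simp [atNode, trace, h]

/-- The incoming half of Kirchhoff's law: a node is reached at time `k + 1` through an edge used at
time `k`. -/
theorem UsesOnly.level_succ_atNode {ι : S → ℝ≥0∞} {E : Finset (List Act × Transition S Act)}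
    (h : σ.UsesOnly ι E) (k : ℕ) (l : List Act) (v : S) :
    σ.level ι (k + 1) (atNode M l v) = ∑ e ∈ E, σ.level ι k (σ.edge e) *
      (open Classical in if e.1 ++ M.traceOf e.2.action = l then e.2.target v else 0) := by
  classical
  simp only [← level_mul_right]
  rw [level_succ, ← level_sum]
  refine level_congr fun α hα => ?_
  rw [next_atNode]
  exact h.tsum_select hα
    (fun e => if e.1 ++ M.traceOf e.2.action = l then e.2.target v else 0)

/-- The outgoing half: mass at a node at time `k` either uses an edge leaving that node or stops. -/
theorem UsesOnly.level_atNode {ι : S → ℝ≥0∞} {E : Finset (List Act × Transition S Act)}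
    (h : σ.UsesOnly ι E) (k : ℕ) (l : List Act) (v : S) :
    σ.level ι k (atNode M l v) = ∑ e ∈ E, σ.level ι k (σ.edge e) *
        (open Classical in if e.1 = l ∧ e.2.source = v then 1 else 0) +
      σ.level ι k (fun α => atNode M l v α * σ.stopProb α) := by
  classical
  simp only [← level_mul_right]
  rw [← level_sum, ← level_add]
  refine level_congr fun α hα => ?_
  rw [← h.tsum_select hα (fun e => if e.1 = l ∧ e.2.source = v then 1 else 0)]
  have : ∑' tr : M.Tr, σ.select α tr * (if M.trace α = l ∧ tr.1.source = v then 1 else 0) =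
      atNode M l v α * ∑' tr : M.Tr, σ.select α tr := by
    rw [← ENNReal.tsum_mul_left]
    refine tsum_congr fun tr => ?_
    by_cases h0 : σ.select α tr = 0
    · simp [h0]
    · rw [σ.source_of_select_ne_zero h0, mul_comm]
      rfl
  rw [this, ← mul_add, tsum_select_add_stopProb, mul_one]

theorem level_zero_atNode (ι : S → ℝ≥0∞) (l : List Act) (v : S) :
    σ.level ι 0 (atNode M l v) = (open Classical in if l = [] then ι v else 0) := by
  classical
  rw [level_zero, tsum_eq_single v]
  · simp [atNode, trace, AltSeq.last, eq_comm]
  · intro w hw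
    simp [atNode, AltSeq.last, hw]

/-- The flow of a scheduler during the first `K` steps. -/
theorem UsesOnly.truncated_flow {ι : S → ℝ≥0∞} {E : Finset (List Act × Transition S Act)}
    (h : σ.UsesOnly ι E) (K : ℕ) (l : List Act) (v : S) :
    (open Classical in if l = [] then ι v else 0) +
      ∑ e ∈ E, (∑ k ∈ Finset.range K, σ.level ι k (σ.edge e)) *
        (open Classical in if e.1 ++ M.traceOf e.2.action = l then e.2.target v else 0) =
    ∑ e ∈ E, (∑ k ∈ Finset.range K, σ.level ι k (σ.edge e)) *
        (open Classical in if e.1 = l ∧ e.2.source = v then 1 else 0) +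
      ∑ k ∈ Finset.range K, σ.level ι k (fun α => atNode M l v α * σ.stopProb α) +
      σ.level ι K (atNode M l v) := by
  simp only [Finset.sum_mul]
  rw [Finset.sum_comm, Finset.sum_comm (s := E)]
  simp only [← h.level_succ_atNode]
  rw [← Finset.sum_add_distrib]
  simp only [← h.level_atNode]
  -- Both sides count the visits at times `0, …, K`; the left one separates time `0`, the right one
  -- time `K`.
  rw [← Finset.sum_range_succ, Finset.sum_range_succ', level_zero_atNode, add_comm]

theorem edge_le_one (e : List Act × Transition S Act) (α : AltSeq S Act) : σ.edge e α ≤ 1 := by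
  unfold edge
  split_ifs
  · exact (ENNReal.le_tsum _).trans (σ.tsum_select_le α)
  · simp
  · simp

theorem level_one_le (ι : S → ℝ≥0∞) (k : ℕ) : σ.level ι k (fun _ => 1) ≤ ∑' s, ι s := by
  rw [← σ.level_one_add_sum_level_stopProb ι k]
  exact le_self_add

end Scheduler

end ProbAut

/-! ### From schedulers to flows: truncation and passage to the limit. -/

namespace ProbAut
open Filter Topology

variable {S Act : Type*} {M : ProbAut S Act}

/-- Vectors whose nonnegative combinations are the differences of the boundary values of flows. -/
def edgeVector (M : ProbAut S Act) (e : List Act × Transition S Act) : List Act × S → ℝ :=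
  open Classical in fun q => (if e.1 = q.1 ∧ e.2.source = q.2 then 1 else 0) -
    (if e.1 ++ M.traceOf e.2.action = q.1 then (e.2.target q.2).toReal else 0)

/-- Read coordinate by coordinate, membership in the cone is the flow equation, with the conic
coefficients as flow. Real vectors allow the signs that `ℝ≥0` lacks. -/
theorem exists_isFlow_of_mem_finCone {a : Act} {A : Finset (Transition S Act)}
    {init halt : S → ℝ≥0}
    (h : (fun q : List Act × S => open Classical in
      ((if q.1 = [] then (init q.2 : ℝ) else 0) -
        (if q.1 = M.traceOf a then (halt q.2 : ℝ) else 0))) ∈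
      finCone (M.edges a A) M.edgeVector) :
    ∃ x, M.IsFlow a A init halt x := by
  classical
  obtain ⟨c, hc, h⟩ := h
  refine ⟨fun e => (c e).toNNReal, fun l v => ?_⟩
  have h := congrFun h (l, v)
  simp only [Finset.sum_apply, Pi.smul_apply, smul_eq_mul, edgeVector, mul_sub, mul_ite, mul_one,
    mul_zero, Finset.sum_sub_distrib] at h
  rw [← NNReal.coe_inj]
  push_cast
  simp only [apply_ite NNReal.toReal, NNReal.coe_mul, NNReal.coe_zero,
    ENNReal.coe_toNNReal_eq_toReal]
  have h1 : ∀ e ∈ M.edges a A, ((c e).toNNReal : ℝ) = c e := fun e he =>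
    Real.coe_toNNReal _ (hc e he)
  have h2 := Finset.sum_congr rfl fun e he =>
    congrArg (fun r => if e.1 ++ M.traceOf e.2.action = l then r * (e.2.target v).toReal else 0)
      (h1 e he)
  have h3 := Finset.sum_congr rfl fun e he =>
    congrArg (fun r => if e.1 = l ∧ e.2.source = v then r else 0) (h1 e he)
  rw [h2, h3]
  linarith

namespace Scheduler

variable {σ : M.Scheduler}

/-- The mass still running is one minus a partial sum of the stopping series, whose total is one. -/
theorem tendsto_level_one {ι : S → ℝ≥0∞} (hι : ∑' s, ι s = 1)
    (h : ∑' α, σ.weight ι α * σ.stopProb α = 1) :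
    Tendsto (fun k => σ.level ι k (fun _ => 1)) atTop (𝓝 0) := by
  have hk : ∀ k, σ.level ι k (fun _ => 1) =
      1 - ∑ j ∈ Finset.range k, σ.level ι j σ.stopProb := by
    intro k
    have := σ.level_one_add_sum_level_stopProb ι k
    rw [hι] at this
    refine ENNReal.eq_sub_of_add_eq ?_ this
    exact ne_top_of_le_ne_top ENNReal.one_ne_top (this ▸ le_add_self)
  simp only [hk]
  rw [σ.tsum_weight_eq_tsum_level] at h
  have := ENNReal.Tendsto.sub (tendsto_const_nhds (x := (1 : ℝ≥0∞)))
    (ENNReal.tendsto_nat_tsum fun j => σ.level ι j σ.stopProb) (Or.inl ENNReal.one_ne_top)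
  rwa [h, tsub_self] at this

/-- A set of sequences that cannot be left, and in which the scheduler never stops, is null. -/
theorem weight_eq_zero_of_absorbing {ι : S → ℝ≥0∞}
    (h1 : Tendsto (fun k => σ.level ι k (fun _ => 1)) atTop (𝓝 0)) (p : AltSeq S Act → Prop)
    (hp : ∀ α a t, p α → p (.snoc α a t))
    (hstopProb : ∀ α, p α → σ.weight ι α * σ.stopProb α = 0)
    {α : AltSeq S Act} (hα : p α) : σ.weight ι α = 0 := by
  classical
  set g : AltSeq S Act → ℝ≥0∞ := fun α => if p α then 1 else 0 with hg
  -- Nothing stops inside the set and nothing leaves it, so its mass cannot decrease in time. It is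
  -- bounded by the running mass, which tends to zero.
  have hmono : ∀ k, σ.level ι k g ≤ σ.level ι (k + 1) g := by
    intro k
    rw [level_succ]
    have : σ.level ι k g = σ.level ι k (fun α => if p α then ∑' tr, σ.select α tr else 0) := by
      refine tsum_congr fun α => ?_
      split_ifs with hl
      on_goal 1 => by_cases hpα : p α
      · have h := hstopProb α hpα
        have := congrArg (σ.weight ι α * ·) (σ.tsum_select_add_stopProb α)
        simp only [mul_add, h, add_zero] at this
        simp [hg, hpα, this]
      · simp [hg, hpα]
      · rfl
    rw [this]
    refine σ.level_mono ι k fun α => ?_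
    split_ifs with hpα
    · refine ENNReal.tsum_le_tsum fun tr => ?_
      simp [hg, hp α _ _ hpα, PMF.tsum_coe]
    · exact zero_le
  have hzero : ∀ k, σ.level ι k g = 0 := by
    intro k
    refine le_antisymm (ge_of_tendsto h1 (eventually_atTop.2 ⟨k, fun n hn => ?_⟩)) (zero_le)
    refine (monotone_nat_of_le_succ hmono hn).trans (σ.level_mono ι n fun α => ?_)
    simp only [hg]
    split_ifs <;> simp
  have := ENNReal.tsum_eq_zero.1 (hzero α.len) α
  simpa [hg, hα] using this

-- The sequences whose trace is not a prefix of `traceOf a` form an absorbing set, since traces only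
-- grow, and stopping there would produce a wrong trace. Hence this set is null.
open Classical in
theorem Induces.usesOnly {s : S} {a : Act} {ν : PMF S} (h : σ.Induces s a ν)
    {A : Finset (Transition S Act)} (hA : σ.Respects A) :
    σ.UsesOnly (fun t => if t = s then 1 else 0) (M.edges a A) := by
  have hfin := h.finite_prob
  rw [prob_univ_eq] at hfin
  have h1 := tendsto_level_one (by simp) hfin
  intro α tr hα htr
  refine Finset.mem_product.2 ⟨?_, ?_⟩
  · rw [mem_phases_iff_prefix]
    by_contra hn
    refine hα (weight_eq_zero_of_absorbing h1 (fun α => ¬ M.trace α <+: M.traceOf a) ?_ ?_ hn)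
    · intro α b t hα hsn
      exact hα ((List.prefix_append _ _).trans hsn)
    · intro α hα
      by_contra hne
      have hf : M.IsFrag α := by
        by_contra hf
        exact hne (by rw [σ.weight_eq_zero_of_not_isFrag _ α hf, zero_mul])
      have := h.trace_eq ⟨α, hf⟩ (by rw [fragProb_eq]; exact pos_iff_ne_zero.2 hne)
      exact hα (by simp [this])
  · unfold select at htr
    split_ifs at htr with hf
    · exact hA ⟨α, hf⟩ tr (pos_iff_ne_zero.2 htr)
    · exact absurd rfl htr

-- The limit is the total probability of stopping at the node, and stopping has positive probability
-- only after a fragment with trace `traceOf a`.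
open Classical in
theorem Induces.tendsto_halt {s : S} {a : Act} {ν : PMF S} (h : σ.Induces s a ν)
    (l : List Act) (v : S) :
    Tendsto (fun K => ∑ k ∈ Finset.range K,
        σ.level (fun t => if t = s then 1 else 0) k (fun α => atNode M l v α * σ.stopProb α))
      atTop (𝓝 (open Classical in if l = M.traceOf a then ν v else 0)) := by
  classical
  convert ENNReal.tendsto_nat_tsum _ using 2
  rw [← tsum_weight_eq_tsum_level]
  have h0 : ∀ α, σ.weight (fun t => if t = s then 1 else 0) α * σ.stopProb α ≠ 0 →
      M.trace α = M.traceOf a := by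
    intro α hne
    have hf : M.IsFrag α := by
      by_contra hf
      exact hne (by rw [σ.weight_eq_zero_of_not_isFrag _ α hf, zero_mul])
    exact h.trace_eq ⟨α, hf⟩ (by rw [fragProb_eq]; exact pos_iff_ne_zero.2 hne)
  split_ifs with hl
  · rw [← h.last_prob, σ.prob_eq s (fun α => α.last = v)]
    refine tsum_congr fun α => ?_
    by_cases hα : σ.weight (fun t => if t = s then 1 else 0) α * σ.stopProb α = 0
    · rw [mul_left_comm, hα]
      simp
    · simp [atNode, h0 α hα, hl]
  · symm
    refine ENNReal.tsum_eq_zero.2 fun α => ?_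
    rw [mul_left_comm]
    by_contra hne
    have hne := mul_ne_zero_iff.1 hne
    have := h0 α hne.2
    refine hne.1 ?_
    simp [atNode, this, Ne.symm hl]

-- The truncated edge counts need not converge to finite values, so the flow is not obtained as
-- their limit. Only their boundary values converge, and closedness of the cone supplies some flow
-- with the limiting boundary.
open Classical in
theorem Induces.exists_isFlow {s : S} {a : Act} {ν : PMF S}
    (h : σ.Induces s a ν) {A : Finset (Transition S Act)} (hA : σ.Respects A) :
    ∃ x, M.IsFlow a A (fun t => if t = s then 1 else 0) (fun v => (ν v).toNNReal) x := by
  classical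
  have hE := h.usesOnly hA
  have hfin := h.finite_prob
  rw [prob_univ_eq] at hfin
  set ι : S → ℝ≥0∞ := fun t => if t = s then 1 else 0 with hι
  have hι1 : ∑' s, ι s = 1 := by simp [hι]
  have h1 := tendsto_level_one hι1 hfin
  have hle : ∀ k g, (∀ α, g α ≤ 1) → σ.level ι k g ≤ 1 := fun k g hg =>
    (σ.level_mono ι k hg).trans (hι1 ▸ σ.level_one_le ι k)
  have hsum : ∀ K (g : AltSeq S Act → ℝ≥0∞), (∀ α, g α ≤ 1) →
      ∑ k ∈ Finset.range K, σ.level ι k g ≠ ∞ := fun K g hg =>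
    ENNReal.sum_ne_top.2 fun k _ => ne_top_of_le_ne_top ENNReal.one_ne_top (hle k g hg)
  have hat : ∀ l v α, atNode M l v α ≤ 1 := fun l v α => by
    unfold atNode; split_ifs <;> simp
  have hats : ∀ l v α, atNode M l v α * σ.stopProb α ≤ 1 := fun l v α =>
    mul_le_one' (hat l v α) tsub_le_self
  apply exists_isFlow_of_mem_finCone
  -- The boundary of the flow truncated at time `K`: the mass still running then is treated as a
  -- second sink, which disappears in the limit.
  let u : ℕ → List Act × S → ℝ := fun K q => (if q.1 = [] then (ι q.2).toReal else 0) -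
    (∑ k ∈ Finset.range K, σ.level ι k (fun α => atNode M q.1 q.2 α * σ.stopProb α)).toReal -
      (σ.level ι K (atNode M q.1 q.2)).toReal
  refine (isClosed_finCone _ _).mem_of_tendsto (f := u) (b := atTop) ?_ (.of_forall fun K => ?_)
  · refine tendsto_pi_nhds.2 fun q => ?_
    have hlim1 := (ENNReal.tendsto_toReal
      (by split_ifs; exacts [PMF.apply_ne_top _ _, ENNReal.zero_ne_top])).comp
        (h.tendsto_halt q.1 q.2)
    have hz : Tendsto (fun K => σ.level ι K (atNode M q.1 q.2)) atTop (𝓝 0) :=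
      tendsto_of_tendsto_of_tendsto_of_le_of_le tendsto_const_nhds h1 (fun _ => zero_le)
        fun K => σ.level_mono ι K (hat _ _)
    have hlim2 := (ENNReal.tendsto_toReal ENNReal.zero_ne_top).comp hz
    have := ((tendsto_const_nhds (x := if q.1 = [] then (ι q.2).toReal else 0)).sub hlim1).sub
      hlim2
    convert this using 2
    · rfl
    simp only [hι, ENNReal.toReal_zero, sub_zero, apply_ite ENNReal.toReal, apply_ite NNReal.toReal,
      ENNReal.toReal_one, NNReal.coe_zero, NNReal.coe_one, ENNReal.coe_toNNReal_eq_toReal]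
  · refine ⟨fun e => (∑ k ∈ Finset.range K, σ.level ι k (σ.edge e)).toReal,
      fun e _ => ENNReal.toReal_nonneg, ?_⟩
    ext q
    have key := congrArg ENNReal.toReal (hE.truncated_flow K q.1 q.2)
    have hx : ∀ e, ∑ k ∈ Finset.range K, σ.level ι k (σ.edge e) ≠ ∞ := fun e =>
      hsum K _ (edge_le_one e)
    have hy1 : ∀ e : List Act × Transition S Act, (if e.1 ++ M.traceOf e.2.action = q.1 then
        e.2.target q.2 else 0) ≠ ∞ := fun e => by
      split_ifs; exacts [PMF.apply_ne_top _ _, ENNReal.zero_ne_top]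
    have hy2 : ∀ e : List Act × Transition S Act, (if e.1 = q.1 ∧ e.2.source = q.2 then
        (1 : ℝ≥0∞) else 0) ≠ ∞ := fun e => by split_ifs <;> simp
    have hi : (if q.1 = [] then ι q.2 else 0) ≠ ∞ := by
      simp only [hι]
      split_ifs <;> simp
    have hs1 := ENNReal.sum_ne_top.2 fun e (_ : e ∈ M.edges a A) =>
      ENNReal.mul_ne_top (hx e) (hy1 e)
    have hs2 := ENNReal.sum_ne_top.2 fun e (_ : e ∈ M.edges a A) =>
      ENNReal.mul_ne_top (hx e) (hy2 e)
    have hs3 := hsum K _ (hats q.1 q.2)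
    rw [ENNReal.toReal_add hi hs1,
      ENNReal.toReal_add (ENNReal.add_ne_top.2 ⟨hs2, hs3⟩)
        (ne_top_of_le_ne_top ENNReal.one_ne_top (hle K _ (hat q.1 q.2))),
      ENNReal.toReal_add hs2 hs3,
      ENNReal.toReal_sum fun e _ => ENNReal.mul_ne_top (hx e) (hy1 e),
      ENNReal.toReal_sum fun e _ => ENNReal.mul_ne_top (hx e) (hy2 e)] at key
    simp only [ENNReal.toReal_mul, apply_ite ENNReal.toReal, ENNReal.toReal_one,
      ENNReal.toReal_zero] at key
    simp only [Finset.sum_apply, Pi.smul_apply, smul_eq_mul, edgeVector, mul_sub,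
      Finset.sum_sub_distrib, u]
    linarith

end Scheduler

end ProbAut

/-! ### Superposition of flows, and termination from finite expected length. -/

namespace ProbAut

variable {S Act : Type*} {M : ProbAut S Act}

theorem IsFlow.sum_smul {β : Type*} {a : Act} {A : Finset (Transition S Act)} (I : Finset β)
    (c : β → ℝ≥0) {init halt : β → S → ℝ≥0} {x : β → List Act × Transition S Act → ℝ≥0}
    (h : ∀ i, M.IsFlow a A (init i) (halt i) (x i)) :
    M.IsFlow a A (fun v => ∑ i ∈ I, c i * init i v) (fun v => ∑ i ∈ I, c i * halt i v)
      (fun e => ∑ i ∈ I, c i * x i e) := by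
  classical
  intro l v
  have h := Finset.sum_congr (s₁ := I) rfl fun i _ => congrArg (c i * ·) (h i l v)
  simp only [mul_add, Finset.sum_add_distrib, Finset.mul_sum, mul_ite, mul_zero] at h
  rw [Finset.sum_comm (s := I), Finset.sum_comm (s := I)] at h
  convert h using 2
  · split_ifs <;> simp
  · refine Finset.sum_congr rfl fun e _ => ?_
    split_ifs
    · simp only [Finset.sum_mul, mul_assoc]
    · simp
  · refine Finset.sum_congr rfl fun e _ => ?_
    split_ifs <;> simp
  · split_ifs <;> simp

/-- The flows from the states in the support of `ρ`, weighted by `ρ`, add up to a flow from `ρ`. -/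
theorem AllowedHyper.exists_isFlow [Finite S] {a : Act} {A : Finset (Transition S Act)}
    {ρ μ : PMF S} (h : M.AllowedHyper A ρ a μ) :
    ∃ x, M.IsFlow a A (fun s => (ρ s).toNNReal) (fun s => (μ s).toNNReal) x := by
  classical
  have := Fintype.ofFinite S
  obtain ⟨ν, hν, hμ⟩ := h
  choose σ hσ hA using hν
  choose x hx using fun s => (hσ s).exists_isFlow (hA s)
  have hsum := IsFlow.sum_smul Finset.univ (fun s : ρ.support => (ρ s).toNNReal) hx
  refine ⟨fun e => ∑ s : ρ.support, (ρ s).toNNReal * x s e, ?_⟩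
  convert hsum using 1
  · ext t
    simp only [mul_ite, mul_one, mul_zero]
    by_cases ht : t ∈ ρ.support
    · rw [Finset.sum_eq_single (⟨t, ht⟩ : ρ.support)]
      · simp
      · rintro s _ hs
        rw [if_neg]
        rintro rfl
        exact hs rfl
      · simp
    · rw [Finset.sum_eq_zero, (PMF.apply_eq_zero_iff _ _).2 ht]
      · rfl
      · rintro s -
        rw [if_neg]
        rintro rfl
        exact ht s.2
  · ext t
    rw [hμ, tsum_fintype, ENNReal.toNNReal_sum fun s _ =>
      ENNReal.mul_ne_top (PMF.apply_ne_top _ _) (PMF.apply_ne_top _ _)]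
    simp [ENNReal.toNNReal_mul]

/-- The total weight is the expected number of visited positions. It equals initial mass plus
continued mass, and also stopped mass plus continued mass; when it is finite, the continued mass
cancels. -/
theorem Scheduler.tsum_weight_stopProb (σ : M.Scheduler) {ι : S → ℝ≥0∞}
    (h : ∑' α, σ.weight ι α ≠ ∞) : ∑' α, σ.weight ι α * σ.stopProb α = ∑' s, ι s := by
  have h1 := σ.tsum_weight_mul ι (fun _ => 1)
  simp only [mul_one, next_one] at h1
  have h2 : ∑' α, σ.weight ι α * ∑' tr, σ.select α tr + ∑' α, σ.weight ι α * σ.stopProb α =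
      ∑' α, σ.weight ι α := by
    rw [← ENNReal.tsum_add]
    refine tsum_congr fun α => ?_
    rw [← mul_add, tsum_select_add_stopProb, mul_one]
  rw [add_comm, h1] at h2
  refine (ENNReal.add_left_inj ?_).1 h2
  exact ne_top_of_le_ne_top h (h1 ▸ le_add_self)

/-! ### From flows to memoryless schedulers. -/

section Memoryless

variable (M) in
/-- The amount of flow leaving a node along edges. -/
def outflow (E : Finset (List Act × Transition S Act))
    (x : List Act × Transition S Act → ℝ≥0) (q : List Act × S) : ℝ≥0∞ :=
  open Classical in ∑ e ∈ E, if e.1 = q.1 ∧ e.2.source = q.2 then (x e : ℝ≥0∞) else 0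

variable (M) in
/-- The total amount of flow leaving a node. -/
def throughput (a : Act) (E : Finset (List Act × Transition S Act))
    (x : List Act × Transition S Act → ℝ≥0) (halt : S → ℝ≥0) (q : List Act × S) : ℝ≥0∞ :=
  outflow E x q + open Classical in if q.1 = M.traceOf a then (halt q.2 : ℝ≥0∞) else 0

theorem outflow_ne_top (E : Finset (List Act × Transition S Act))
    (x : List Act × Transition S Act → ℝ≥0) (q : List Act × S) : outflow E x q ≠ ∞ :=
  ENNReal.sum_ne_top.2 fun e _ => by split_ifs <;> simp

theorem throughput_ne_top (a : Act) (E : Finset (List Act × Transition S Act))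
    (x : List Act × Transition S Act → ℝ≥0) (halt : S → ℝ≥0) (q : List Act × S) :
    M.throughput a E x halt q ≠ ∞ :=
  ENNReal.add_ne_top.2 ⟨outflow_ne_top E x q, by split_ifs <;> simp⟩

theorem tsum_throughput_ne_top [Finite S] (a : Act) (E : Finset (List Act × Transition S Act))
    (x : List Act × Transition S Act → ℝ≥0) (halt : S → ℝ≥0) :
    ∑' q, M.throughput a E x halt q ≠ ∞ := by
  classical
  have := Fintype.ofFinite S
  simp only [throughput, outflow]
  rw [ENNReal.tsum_add]
  refine ENNReal.add_ne_top.2 ⟨?_, ?_⟩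
  · rw [Summable.tsum_finsetSum fun _ _ => ENNReal.summable]
    refine ENNReal.sum_ne_top.2 fun e _ => ?_
    rw [tsum_eq_single (e.1, e.2.source)]
    · simp
    · rintro ⟨l, v⟩ hq
      rw [if_neg]
      rintro ⟨rfl, rfl⟩
      exact hq rfl
  · rw [ENNReal.tsum_prod', tsum_eq_single (M.traceOf a)]
    · simp [tsum_fintype]
    · intro l hl
      simp [hl]

theorem tsum_tr_eq_outflow {E : Finset (List Act × Transition S Act)}
    (hE : ∀ e ∈ E, e.2 ∈ M.trans) (x : List Act × Transition S Act → ℝ≥0) (q : List Act × S) :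
    (open Classical in ∑' tr : M.Tr, if (q.1, tr.1) ∈ E ∧ tr.1.source = q.2 then
      (x (q.1, tr.1) : ℝ≥0∞) else 0) = outflow E x q := by
  classical
  obtain ⟨l, v⟩ := q
  let f : List Act × Transition S Act → ℝ≥0∞ := fun e =>
    if e ∈ E ∧ e.1 = l ∧ e.2.source = v then x e else 0
  have h1 : outflow E x (l, v) = ∑' e, f e := by
    rw [tsum_eq_sum (s := E) fun e he => by simp [f, he]]
    exact Finset.sum_congr rfl fun e he => by simp [f, he]
  rw [h1, ENNReal.tsum_prod', tsum_eq_single l]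
  · refine Eq.trans ?_ ((tsum_subtype M.trans (fun tr => f (l, tr))).trans ?_)
    · simp [f]
    · refine tsum_congr fun tr => Set.indicator_apply_eq_self.2 fun htr => ?_
      exact if_neg fun h => htr (hE _ h.1)
  · intro k hk
    simp [f, hk]

/-- The scheduler that follows a flow: the next transition only depends on the trace and the last
state of the past, and is chosen with probability proportional to the flow. -/
def flowScheduler (a : Act) {E : Finset (List Act × Transition S Act)}
    (hE : ∀ e ∈ E, e.2 ∈ M.trans) (x : List Act × Transition S Act → ℝ≥0) (halt : S → ℝ≥0) :
    M.Scheduler where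
  -- Where the throughput is zero every numerator is zero too, and `0 / 0 = 0` in `ℝ≥0∞`, so the
  -- scheduler stops there.
  choice α := ⟨fun tr => open Classical in
    (if (M.trace α.1, tr.1) ∈ E ∧ tr.1.source = α.1.last then
      (x (M.trace α.1, tr.1) : ℝ≥0∞) else 0) / M.throughput a E x halt (M.trace α.1, α.1.last), by
    simp only [div_eq_mul_inv]
    rw [ENNReal.tsum_mul_right, tsum_tr_eq_outflow hE x (M.trace α.1, α.1.last)]
    exact ENNReal.div_le_of_le_mul (by rw [one_mul]; exact le_self_add)⟩
  enabled α tr h := by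
    classical
    by_contra hne
    simp [SubDisc.supp, hne] at h

variable {a : Act} {E : Finset (List Act × Transition S Act)} (hE : ∀ e ∈ E, e.2 ∈ M.trans)
  (x : List Act × Transition S Act → ℝ≥0) (halt : S → ℝ≥0)

theorem flowScheduler_select_of_isFrag {α : AltSeq S Act} (hα : M.IsFrag α) (tr : M.Tr) :
    (flowScheduler a hE x halt).select α tr = (open Classical in
      if (M.trace α, tr.1) ∈ E ∧ tr.1.source = α.last then (x (M.trace α, tr.1) : ℝ≥0∞) else 0) /
        M.throughput a E x halt (M.trace α, α.last) := by
  simp [Scheduler.select, hα, flowScheduler]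

theorem flowScheduler_stopProb_of_isFrag {α : AltSeq S Act} (hα : M.IsFrag α) :
    (flowScheduler a hE x halt).stopProb α =
      1 - outflow E x (M.trace α, α.last) / M.throughput a E x halt (M.trace α, α.last) := by
  rw [Scheduler.stopProb, ← tsum_tr_eq_outflow hE]
  simp only [flowScheduler_select_of_isFrag hE x halt hα, div_eq_mul_inv, ENNReal.tsum_mul_right]

theorem flowScheduler_mem_of_select_ne_zero {α : AltSeq S Act} {tr : M.Tr}
    (h : (flowScheduler a hE x halt).select α tr ≠ 0) : (M.trace α, tr.1) ∈ E := by
  by_cases hα : M.IsFrag α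
  · rw [flowScheduler_select_of_isFrag hE x halt hα] at h
    by_contra hn
    simp [hn] at h
  · exact absurd (by simp [Scheduler.select, hα]) h

theorem flowScheduler_usesOnly (ι : S → ℝ≥0∞) :
    (flowScheduler a hE x halt).UsesOnly ι E :=
  fun _ _ _ h => flowScheduler_mem_of_select_ne_zero hE x halt h

/-- The choice probability is constant on the fragments ending at a given node, so it factors out of
the expectation. -/
theorem flowScheduler_level_edge (ι : S → ℝ≥0∞) (k : ℕ) {e : List Act × Transition S Act}
    (he : e ∈ E) :
    (flowScheduler a hE x halt).level ι k ((flowScheduler a hE x halt).edge e) =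
      (flowScheduler a hE x halt).level ι k (Scheduler.atNode M e.1 e.2.source) *
        (x e / M.throughput a E x halt (e.1, e.2.source)) := by
  classical
  rw [← Scheduler.level_mul_right]
  refine Scheduler.level_congr fun α hα => ?_
  have hf : M.IsFrag α := by
    by_contra hf
    exact hα (Scheduler.weight_eq_zero_of_not_isFrag _ _ _ hf)
  unfold Scheduler.edge Scheduler.atNode
  by_cases h1 : M.trace α = e.1
  · rw [if_pos h1, dif_pos (hE e he), flowScheduler_select_of_isFrag hE x halt hf]
    by_cases h2 : α.last = e.2.source
    · simp [h1, h2, he]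
    · simp [h1, h2, Ne.symm h2]
  · simp [h1]

/-- The expected number of visits of a node is at most the flow through the node. -/
theorem flowScheduler_tsum_atNode_le {A : Finset (Transition S Act)} {init : S → ℝ≥0}
    (hE : ∀ e ∈ M.edges a A, e.2 ∈ M.trans) (h : M.IsFlow a A init halt x)
    (l : List Act) (v : S) :
    ∑' α, (flowScheduler a hE x halt).weight (fun s => init s) α * Scheduler.atNode M l v α ≤
      M.throughput a (M.edges a A) x halt (l, v) := by
  classical
  rw [Scheduler.tsum_weight_eq_tsum_level]
  refine ENNReal.tsum_le_of_sum_range_le fun K => ?_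
  set σ := flowScheduler a hE x halt
  have hfl : ∀ l v, M.throughput a (M.edges a A) x halt (l, v) =
      (if l = [] then (init v : ℝ≥0∞) else 0) +
        ∑ e ∈ M.edges a A, x e * (if e.1 ++ M.traceOf e.2.action = l then e.2.target v else 0) := by
    intro l v
    have := congrArg (fun r : ℝ≥0 => (r : ℝ≥0∞)) (h l v)
    push_cast at this
    simp only [apply_ite ENNReal.ofNNReal, ENNReal.coe_mul, ENNReal.coe_zero,
      ENNReal.coe_toNNReal (PMF.apply_ne_top _ _)] at this
    simp only [throughput, outflow, mul_ite, mul_zero]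
    exact this.symm
  -- Visits at time `0` are bounded by `init`. Later visits enter through edges, and an edge whose
  -- source is visited at most as often as its throughput is used at most `x e` times. Equality can
  -- fail, since the flow may contain unreached circulations.
  induction K generalizing l v with
  | zero => simp
  | succ K ih =>
    rw [Finset.sum_range_succ', Scheduler.level_zero_atNode, add_comm, hfl]
    gcongr
    simp only [(flowScheduler_usesOnly hE x halt _).level_succ_atNode, σ]
    rw [Finset.sum_comm]
    refine Finset.sum_le_sum fun e he => ?_
    rw [← Finset.sum_mul]
    gcongr
    rw [Finset.sum_congr rfl fun k _ => flowScheduler_level_edge hE x halt _ k he,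
      ← Finset.sum_mul]
    calc _ ≤ M.throughput a (M.edges a A) x halt (e.1, e.2.source) *
          (x e / M.throughput a (M.edges a A) x halt (e.1, e.2.source)) := by
          gcongr
          exact ih _ _
      _ ≤ x e := ENNReal.mul_div_le

theorem tsum_atNode (α : AltSeq S Act) :
    ∑' q : List Act × S, Scheduler.atNode M q.1 q.2 α = 1 := by
  rw [tsum_eq_single (M.trace α, α.last)]
  · simp [Scheduler.atNode]
  · rintro ⟨l, v⟩ hq
    refine if_neg ?_
    rintro ⟨rfl, rfl⟩
    exact hq rfl

/-- Each sequence sits at exactly one node, so the total weight is the sum of the visits to all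
nodes, bounded by the finite total throughput. -/
theorem flowScheduler_tsum_weight_ne_top [Finite S] {A : Finset (Transition S Act)}
    {init : S → ℝ≥0}
    (hE : ∀ e ∈ M.edges a A, e.2 ∈ M.trans) (h : M.IsFlow a A init halt x) :
    ∑' α, (flowScheduler a hE x halt).weight (fun s => init s) α ≠ ∞ := by
  refine ne_top_of_le_ne_top (tsum_throughput_ne_top a (M.edges a A) x halt (M := M)) ?_
  calc _ = ∑' (α) (q : List Act × S), (flowScheduler a hE x halt).weight (fun s => init s) α *
        Scheduler.atNode M q.1 q.2 α := by simp only [ENNReal.tsum_mul_left, tsum_atNode, mul_one]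
    _ = ∑' (q : List Act × S) (α), (flowScheduler a hE x halt).weight (fun s => init s) α *
        Scheduler.atNode M q.1 q.2 α := ENNReal.tsum_comm
    _ ≤ _ := ENNReal.tsum_le_tsum fun q => flowScheduler_tsum_atNode_le x halt hE h q.1 q.2

/-- With throughput `F`, at most `F` visits, each stopping with probability `1 - outflow / F`, stop
at most the mass `F - outflow`, which is the halting flow. For `F = 0` there are no visits. -/
theorem flowScheduler_tsum_stopProb_le {A : Finset (Transition S Act)} {init : S → ℝ≥0}
    (hE : ∀ e ∈ M.edges a A, e.2 ∈ M.trans) (h : M.IsFlow a A init halt x)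
    (l : List Act) (v : S) :
    ∑' α, (flowScheduler a hE x halt).weight (fun s => init s) α * (Scheduler.atNode M l v α *
        (flowScheduler a hE x halt).stopProb α) ≤
      open Classical in if l = M.traceOf a then (halt v : ℝ≥0∞) else 0 := by
  classical
  have hN := flowScheduler_tsum_atNode_le x halt hE h l v
  set σ := flowScheduler a hE x halt
  set F := M.throughput a (M.edges a A) x halt (l, v) with hF
  have hstopProb : ∀ α, σ.weight (fun s => init s) α * (Scheduler.atNode M l v α * σ.stopProb α) =
      σ.weight (fun s => init s) α * Scheduler.atNode M l v α *
        (1 - outflow (M.edges a A) x (l, v) / F) := by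
    intro α
    by_cases hf : M.IsFrag α
    · rw [flowScheduler_stopProb_of_isFrag hE x halt hf, mul_assoc]
      unfold Scheduler.atNode
      split_ifs with hα
      · rw [hα.1, hα.2]
      · simp
    · simp [σ.weight_eq_zero_of_not_isFrag _ _ hf]
  simp only [hstopProb, ENNReal.tsum_mul_right]
  by_cases hF0 : F = 0
  · rw [hF0] at hN
    simp [le_antisymm hN bot_le]
  · have hFt : F ≠ ∞ := throughput_ne_top _ _ _ _ _
    calc _ ≤ F * (1 - outflow (M.edges a A) x (l, v) / F) := by gcongr
      _ = F - outflow (M.edges a A) x (l, v) := by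
        rw [ENNReal.mul_sub fun _ _ => hFt, mul_one, ENNReal.mul_div_cancel hF0 hFt]
      _ ≤ _ := by
        rw [tsub_le_iff_left]
        exact le_of_eq hF

end Memoryless

theorem Scheduler.Induces.of_weight {σ : M.Scheduler} {s : S} {a : Act} {ν : PMF S}
    (h1 : (open Classical in
      ∑' α, σ.weight (fun t => if t = s then 1 else 0) α * σ.stopProb α) = 1)
    (h2 : ∀ α, (open Classical in
      σ.weight (fun t => if t = s then 1 else 0) α * σ.stopProb α) ≠ 0 → M.trace α = M.traceOf a)
    (h3 : ∀ v, (open Classical in ∑' α, σ.weight (fun t => if t = s then 1 else 0) α *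
      (atNode M (M.traceOf a) v α * σ.stopProb α)) = ν v) : σ.Induces s a ν where
  finite_prob := by rw [prob_univ_eq, h1]
  trace_eq α hα := h2 α.1 (by rw [fragProb_eq] at hα; exact hα.ne')
  last_prob v := by
    classical
    rw [← h3, σ.prob_eq s (fun α => α.last = v)]
    refine tsum_congr fun α => ?_
    rw [mul_left_comm]
    by_cases hα : σ.weight (fun t => if t = s then 1 else 0) α * σ.stopProb α = 0
    · simp [hα]
    · simp [atNode, h2 α hα]

/-- Almost sure termination gives the stopped masses total one, as for the prescribed halting
masses, so the nodewise inequality is an equality. Properties of the run from `ρ` pass to the run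
from each `s` in the support, because the former is a combination of the latter with coefficients `ρ
s` that are positive there. -/
theorem IsFlow.exists_scheduler [Finite S] {a : Act} {A : Finset (Transition S Act)}
    (hA : ↑A ⊆ M.trans) {ρ μ : PMF S} {x : List Act × Transition S Act → ℝ≥0}
    (h : M.IsFlow a A (fun s => (ρ s).toNNReal) (fun s => (μ s).toNNReal) x) :
    ∃ σ : M.Scheduler, σ.InducesHyper ρ a μ ∧ σ.Respects A := by
  classical
  have hE : ∀ e ∈ M.edges a A, e.2 ∈ M.trans := fun e he => hA (Finset.mem_product.1 he).2
  have hfin := flowScheduler_tsum_weight_ne_top x _ hE h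
  have hle := flowScheduler_tsum_stopProb_le x _ hE h
  set σ := flowScheduler a hE x fun s => (μ s).toNNReal with hσ
  simp only [ENNReal.coe_toNNReal (PMF.apply_ne_top _ _)] at hfin hle
  have htot := σ.tsum_weight_stopProb hfin
  rw [PMF.tsum_coe] at htot
  have hw : ∀ α, σ.weight (fun s => ρ s) α =
      ∑' s, ρ s * σ.weight (fun t => if t = s then 1 else 0) α := σ.weight_eq_tsum ρ
  have hsum : ∑' q : List Act × S, ∑' α, σ.weight (fun s => ρ s) α *
      (Scheduler.atNode M q.1 q.2 α * σ.stopProb α) = 1 := by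
    rw [ENNReal.tsum_comm, ← htot]
    refine tsum_congr fun α => ?_
    rw [ENNReal.tsum_mul_left, ENNReal.tsum_mul_right, tsum_atNode, one_mul]
  have hsum' : ∑' q : List Act × S, (if q.1 = M.traceOf a then μ q.2 else 0) = 1 := by
    rw [ENNReal.tsum_prod', tsum_eq_single (M.traceOf a)]
    · simp [PMF.tsum_coe]
    · intro l hl
      simp [hl]
  have heq : ∀ l v, ∑' α, σ.weight (fun s => ρ s) α *
      (Scheduler.atNode M l v α * σ.stopProb α) = if l = M.traceOf a then μ v else 0 := by
    intro l v
    -- A strict inequality at one node would make the two totals, both equal to one, differ.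
    refine (hle l v).antisymm (le_of_not_gt fun hlt => ?_)
    have := ENNReal.tsum_lt_tsum (f := fun q : List Act × S => ∑' α, σ.weight (fun s => ρ s) α *
      (Scheduler.atNode M q.1 q.2 α * σ.stopProb α)) (i := (l, v)) (by rw [hsum]; simp)
      (fun q => hle q.1 q.2) hlt
    rw [hsum, hsum'] at this
    exact lt_irrefl _ this
  have h2 : ∀ s ∈ ρ.support, ∀ α,
      σ.weight (fun t => if t = s then 1 else 0) α * σ.stopProb α ≠ 0 →
        M.trace α = M.traceOf a := by
    intro s hs α hα
    by_contra hne
    have h0 := heq (M.trace α) α.last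
    rw [if_neg hne, ENNReal.tsum_eq_zero] at h0
    have h0 := h0 α
    have hα' := mul_ne_zero_iff.1 hα
    simp only [Scheduler.atNode, and_self, if_true, one_mul, mul_eq_zero, hα'.2, or_false, hw,
      ENNReal.tsum_eq_zero] at h0
    rcases h0 s with h0 | h0
    · exact hs h0
    · exact hα'.1 h0
  have h1 : ∀ s ∈ ρ.support,
      ∑' α, σ.weight (fun t => if t = s then 1 else 0) α * σ.stopProb α = 1 := by
    intro s hs
    have : ∑' α, σ.weight (fun t => if t = s then 1 else 0) α ≠ ∞ := by
      intro htop
      refine hfin ?_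
      simp only [hw]
      rw [ENNReal.tsum_comm]
      refine ENNReal.tsum_eq_top_of_eq_top ⟨s, ?_⟩
      rw [ENNReal.tsum_mul_left, htop, ENNReal.mul_top hs]
    rw [σ.tsum_weight_stopProb this]
    simp
  -- The law of the last state of the run from `s`. Its total is the stopping probability, since
  -- every stopped sequence has trace `traceOf a`.
  let ν : ρ.support → PMF S := fun s =>
    ⟨fun v => ∑' α, σ.weight (fun t => if t = s.1 then 1 else 0) α *
      (Scheduler.atNode M (M.traceOf a) v α * σ.stopProb α), by
      rw [Summable.hasSum_iff ENNReal.summable, ENNReal.tsum_comm]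
      refine Eq.trans ?_ (h1 s s.2)
      refine tsum_congr fun α => ?_
      simp only [mul_left_comm _ _ (σ.stopProb α)]
      rw [ENNReal.tsum_mul_right]
      by_cases hα : σ.weight (fun t => if t = s.1 then 1 else 0) α * σ.stopProb α = 0
      · simp [hα]
      · simp [Scheduler.atNode, h2 s s.2 α hα]⟩
  refine ⟨σ, ⟨ν, fun s => .of_weight (h1 s s.2) (h2 s s.2) fun v => rfl, fun t => ?_⟩, ?_⟩
  · have ht := heq (M.traceOf a) t
    rw [if_pos rfl] at ht
    rw [← ht]
    simp only [hw, ← ENNReal.tsum_mul_right]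
    rw [ENNReal.tsum_comm]
    refine Eq.trans ?_ (tsum_subtype ρ.support (fun s => ρ s * ∑' α,
      σ.weight (fun t => if t = s then 1 else 0) α *
        (Scheduler.atNode M (M.traceOf a) t α * σ.stopProb α))).symm
    refine tsum_congr fun s => ?_
    simp only [mul_assoc, ENNReal.tsum_mul_left]
    symm
    refine Set.indicator_apply_eq_self.2 fun hs => ?_
    rw [(PMF.apply_eq_zero_iff _ _).2 hs, zero_mul]
  · intro α tr htr
    have h0 : 0 < (σ.choice α).1 tr := htr
    have : σ.select α.1 tr ≠ 0 := by simpa [Scheduler.select, α.2] using h0.ne'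
    exact (Finset.mem_product.1 (flowScheduler_mem_of_select_ne_zero hE x _ this)).2

end ProbAut

/-! ### The arcs of the LP network. -/

namespace ProbAut

section Network

variable {S Act : Type*} (M : ProbAut S Act)

/-- An explicit description of the arcs of the network. -/
def IsArc (t : S) (a : Act) (A : Set (Transition S Act)) (R : Setoid S) :
    M.Vertex R → M.Vertex R → Prop
  | .source, .state v => v = t
  | .cls _, .sink => True
  | .state v, .cls C => a ∈ M.hidden ∧ Quotient.mk R v = C
  | .stateA v, .cls C => a ∉ M.hidden ∧ Quotient.mk R v = C
  | .state v, .tr tr => tr.1 ∈ A ∧ tr.1.action ∈ M.hidden ∧ tr.1.source = v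
  | .tr tr, .state v => tr.1 ∈ A ∧ tr.1.action ∈ M.hidden ∧ v ∈ tr.1.target.support
  | .stateA v, .trA tr => a ∉ M.hidden ∧ tr.1 ∈ A ∧ tr.1.action ∈ M.hidden ∧ tr.1.source = v
  | .state v, .trA tr => a ∉ M.hidden ∧ tr.1 ∈ A ∧ tr.1.action = a ∧ tr.1.source = v
  | .trA tr, .stateA v => a ∉ M.hidden ∧ tr.1 ∈ A ∧ (tr.1.action ∈ M.hidden ∨ tr.1.action = a) ∧
      v ∈ tr.1.target.support
  | _, _ => False

variable {M}

/-- With arcs given by matching on the two endpoints, `simp` can evaluate the conservation sums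
separately for each kind of vertex. -/
theorem arc_iff_isArc {t : S} {a : Act} {A : Set (Transition S Act)} {R : Setoid S}
    {u v : M.Vertex R} : M.Arc t a A R u v ↔ M.IsArc t a A R u v := by
  constructor
  · rintro (_ | _ | _ | _ | _ | _ | _ | _ | _ | _) <;> simp_all [IsArc]
  · intro h
    cases u <;> cases v <;> simp only [IsArc] at h
    · exact h ▸ .source
    · obtain ⟨h1, h2, h3⟩ := h
      exact h3 ▸ .intIn _ h1 h2
    · obtain ⟨h0, h1, h2, h3⟩ := h
      exact h3 ▸ .extIn _ h0 h1 h2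
    · obtain ⟨h0, h1⟩ := h
      exact h1 ▸ .halt _ h0
    · obtain ⟨h1, h2, h3⟩ := h
      exact .intOut _ _ h1 h2 h3
    · obtain ⟨h0, h1, h2, h3⟩ := h
      exact h3 ▸ .intInA _ h0 h1 h2
    · obtain ⟨h0, h1⟩ := h
      exact h1 ▸ .haltA _ h0
    · obtain ⟨h0, h1, h2 | h2, h3⟩ := h
      · exact .intOutA _ _ h0 h1 h2 h3
      · exact .extOut _ _ h0 h1 h2 h3
    · exact .sink _

/-- Vertices are a disjoint union. -/
def vertexEquiv (R : Setoid S) :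
    M.Vertex R ≃ Bool ⊕ (S ⊕ M.Tr) ⊕ (S ⊕ M.Tr) ⊕ Quotient R where
  toFun := Vertex.toSum
  invFun
    | .inl true => .source
    | .inl false => .sink
    | .inr (.inl (.inl v)) => .state v
    | .inr (.inl (.inr x)) => .tr x
    | .inr (.inr (.inl (.inl v))) => .stateA v
    | .inr (.inr (.inl (.inr x))) => .trA x
    | .inr (.inr (.inr C)) => .cls C
  left_inv x := by cases x <;> rfl
  right_inv x := by rcases x with (_ | _) | (_ | _) | (_ | _) | _ <;> rfl

theorem sum_vertex [Fintype S] [Fintype M.Tr] {R : Setoid S} [Fintype (Quotient R)]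
    [Fintype (M.Vertex R)] (g : M.Vertex R → ℝ) :
    ∑ u, g u = g .source + g .sink + (∑ v, g (.state v) + ∑ tr, g (.tr tr)) +
      (∑ v, g (.stateA v) + ∑ tr, g (.trA tr)) + ∑ C, g (.cls C) := by
  rw [← (vertexEquiv R).symm.sum_comp]
  simp only [Fintype.sum_sum_type, Fintype.sum_bool, vertexEquiv, Equiv.coe_fn_symm_mk]
  ring

/-! ### Inflow and outflow at each kind of vertex. -/

section InOut

variable [Finite S] [Fintype S] [Fintype M.Tr] {R : Setoid S} [Fintype (Quotient R)]
  (t : S) (a : Act) (A : Set (Transition S Act)) (f : M.Vertex R → M.Vertex R → ℝ)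

open Classical in
theorem inflow_state (v : S) : ∑ u with M.Arc t a A R u (.state v), f u (.state v) =
    (if v = t then f .source (.state v) else 0) + ∑ tr : M.Tr,
      if tr.1 ∈ A ∧ tr.1.action ∈ M.hidden ∧ v ∈ tr.1.target.support then
        f (.tr tr) (.state v) else 0 := by
  simp only [arc_iff_isArc, Finset.sum_filter, sum_vertex, IsArc]
  simp

open Classical in
theorem outflow_state (v : S) : ∑ u with M.Arc t a A R (.state v) u, f (.state v) u =
    (if a ∈ M.hidden then f (.state v) (.cls (Quotient.mk R v)) else 0) +
    (∑ tr : M.Tr, if tr.1 ∈ A ∧ tr.1.action ∈ M.hidden ∧ tr.1.source = v then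
        f (.state v) (.tr tr) else 0) +
    ∑ tr : M.Tr, if a ∉ M.hidden ∧ tr.1 ∈ A ∧ tr.1.action = a ∧ tr.1.source = v then
        f (.state v) (.trA tr) else 0 := by
  simp only [arc_iff_isArc, Finset.sum_filter, sum_vertex, IsArc]
  by_cases ha : a ∈ M.hidden <;> simp [ha] <;> ring_nf

open Classical in
theorem inflow_tr (tr : M.Tr) : ∑ u with M.Arc t a A R u (.tr tr), f u (.tr tr) =
    if tr.1 ∈ A ∧ tr.1.action ∈ M.hidden then f (.state tr.1.source) (.tr tr) else 0 := by
  simp only [arc_iff_isArc, Finset.sum_filter, sum_vertex, IsArc]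
  by_cases h1 : tr.1 ∈ A <;> by_cases h2 : tr.1.action ∈ M.hidden <;> simp [h1, h2]

open Classical in
theorem outflow_tr (tr : M.Tr) : ∑ u with M.Arc t a A R (.tr tr) u, f (.tr tr) u =
    ∑ v, if tr.1 ∈ A ∧ tr.1.action ∈ M.hidden ∧ v ∈ tr.1.target.support then
      f (.tr tr) (.state v) else 0 := by
  simp only [arc_iff_isArc, Finset.sum_filter, sum_vertex, IsArc]
  simp

open Classical in
theorem inflow_stateA (v : S) : ∑ u with M.Arc t a A R u (.stateA v), f u (.stateA v) =
    ∑ tr : M.Tr, if a ∉ M.hidden ∧ tr.1 ∈ A ∧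
        (tr.1.action ∈ M.hidden ∨ tr.1.action = a) ∧ v ∈ tr.1.target.support then
      f (.trA tr) (.stateA v) else 0 := by
  simp only [arc_iff_isArc, Finset.sum_filter, sum_vertex, IsArc]
  simp

open Classical in
theorem outflow_stateA (v : S) : ∑ u with M.Arc t a A R (.stateA v) u, f (.stateA v) u =
    (if a ∉ M.hidden then f (.stateA v) (.cls (Quotient.mk R v)) else 0) +
    ∑ tr : M.Tr, if a ∉ M.hidden ∧ tr.1 ∈ A ∧ tr.1.action ∈ M.hidden ∧ tr.1.source = v then
        f (.stateA v) (.trA tr) else 0 := by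
  simp only [arc_iff_isArc, Finset.sum_filter, sum_vertex, IsArc]
  by_cases ha : a ∈ M.hidden <;> simp [ha] <;> ring_nf

open Classical in
theorem inflow_trA (tr : M.Tr) : ∑ u with M.Arc t a A R u (.trA tr), f u (.trA tr) =
    (if a ∉ M.hidden ∧ tr.1 ∈ A ∧ tr.1.action = a then
      f (.state tr.1.source) (.trA tr) else 0) +
    if a ∉ M.hidden ∧ tr.1 ∈ A ∧ tr.1.action ∈ M.hidden then
      f (.stateA tr.1.source) (.trA tr) else 0 := by
  simp only [arc_iff_isArc, Finset.sum_filter, sum_vertex, IsArc]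
  by_cases ha : a ∈ M.hidden <;> by_cases h1 : tr.1 ∈ A <;>
    by_cases h2 : tr.1.action ∈ M.hidden <;> by_cases h3 : tr.1.action = a <;>
    simp [ha, h1, h2, h3]

open Classical in
theorem outflow_trA (tr : M.Tr) : ∑ u with M.Arc t a A R (.trA tr) u, f (.trA tr) u =
    ∑ v, if a ∉ M.hidden ∧ tr.1 ∈ A ∧ (tr.1.action ∈ M.hidden ∨ tr.1.action = a) ∧
        v ∈ tr.1.target.support then
      f (.trA tr) (.stateA v) else 0 := by
  simp only [arc_iff_isArc, Finset.sum_filter, sum_vertex, IsArc]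
  simp

open Classical in
theorem inflow_cls (C : Quotient R) : ∑ u with M.Arc t a A R u (.cls C), f u (.cls C) =
    ∑ v with Quotient.mk R v = C,
      if a ∈ M.hidden then f (.state v) (.cls C) else f (.stateA v) (.cls C) := by
  simp only [arc_iff_isArc, Finset.sum_filter, sum_vertex, IsArc]
  by_cases ha : a ∈ M.hidden <;> simp [ha]

open Classical in
theorem outflow_cls (C : Quotient R) : ∑ u with M.Arc t a A R (.cls C) u, f (.cls C) u =
    f (.cls C) .sink := by
  simp only [arc_iff_isArc, Finset.sum_filter, sum_vertex, IsArc]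
  simp

end InOut

theorem sum_tr_eq [Fintype M.Tr] {A : Finset (Transition S Act)} (hA : ↑A ⊆ M.trans)
    {h : M.Tr → ℝ} {g : Transition S Act → ℝ}
    (H : ∀ tr, h tr = open Classical in if tr.1 ∈ A then g tr.1 else 0) :
    ∑ tr, h tr = ∑ tr ∈ A, g tr := by
  classical
  rw [Finset.sum_congr rfl fun tr _ => H tr, ← Finset.sum_filter]
  refine Finset.sum_bij (fun tr _ => tr.1) ?_ ?_ ?_ ?_
  · simp
  · intro x _ y _ h
    exact Subtype.ext h
  · intro tr htr
    exact ⟨⟨tr, hA htr⟩, by simpa using htr, rfl⟩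
  · intro _ _
    rfl

end Network

/-! ### The flow equations as conservation laws on one or two layers. -/

section FlowEquations

variable {S Act : Type*} {M : ProbAut S Act} {a : Act} {A : Finset (Transition S Act)}
  {init halt : S → ℝ≥0} {x : List Act × Transition S Act → ℝ≥0}

/-- A node whose trace is not in `phases a` has no outgoing edge, no source and no sink, so its
inflow, a sum of nonnegative terms, is zero. At a state in the support of the target this forces the
flow on the edge itself to vanish. -/
theorem IsFlow.eq_zero (h : M.IsFlow a A init halt x) {l : List Act} (hl : l ∈ M.phases a)
    {tr : Transition S Act} (htr : tr ∈ A) (hn : l ++ M.traceOf tr.action ∉ M.phases a) :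
    x (l, tr) = 0 := by
  classical
  obtain ⟨v, hv⟩ := tr.target.support_nonempty
  have h := h (l ++ M.traceOf tr.action) v
  have h1 : l ++ M.traceOf tr.action ≠ M.traceOf a := fun h =>
    hn (h ▸ M.traceOf_mem_phases a)
  have h2 : l ++ M.traceOf tr.action ≠ [] := fun h => hn (h ▸ M.nil_mem_phases a)
  rw [if_neg h1, if_neg h2, zero_add, add_zero, Finset.sum_eq_zero (s := M.edges a A)
    (f := fun e => if e.1 = l ++ M.traceOf tr.action ∧ e.2.source = v then x e else 0)] at h
  · have := Finset.sum_eq_zero_iff.1 h (l, tr) (Finset.mem_product.2 ⟨hl, htr⟩)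
    rw [if_pos rfl] at this
    refine (mul_eq_zero.1 this).resolve_right ?_
    rw [ENNReal.toNNReal_eq_zero_iff]
    exact not_or.2 ⟨hv, PMF.apply_ne_top _ _⟩
  · intro e he
    refine if_neg fun h => hn ?_
    rw [← h.1]
    exact (Finset.mem_product.1 he).1

/-- Only the trace `[]` is present and an external transition would leave it. What remains is
conservation at the vertices `state v`. -/
theorem isFlow_iff_of_mem_hidden (ha : a ∈ M.hidden) :
    M.IsFlow a A init halt x ↔
      (∀ tr ∈ A, tr.action ∉ M.hidden → x ([], tr) = 0) ∧
      ∀ v, open Classical in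
        init v + ∑ tr ∈ A,
          (if tr.action ∈ M.hidden then x ([], tr) * (tr.target v).toNNReal else 0) =
        ∑ tr ∈ A, (if tr.action ∈ M.hidden ∧ tr.source = v then x ([], tr) else 0) + halt v := by
  classical
  have hta : M.traceOf a = [] := by simp [traceOf, ha]
  have ht : ∀ b, M.traceOf b = [] ↔ b ∈ M.hidden := fun b => by
    unfold traceOf; split_ifs with h <;> simp [h]
  constructor
  · intro h
    have h0 : ∀ tr ∈ A, tr.action ∉ M.hidden → x ([], tr) = 0 := fun tr htr hh =>
      h.eq_zero (M.nil_mem_phases a) htr (by simpa [phases, hta, ht] using hh)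
    refine ⟨h0, fun v => ?_⟩
    have h := h [] v
    simp only [edges, M.phases_of_mem_hidden ha, Finset.sum_product, Finset.sum_singleton, hta,
      if_true, List.nil_append, ht, true_and] at h
    rw [h]
    congr 1
    refine Finset.sum_congr rfl fun tr htr => ?_
    by_cases hh : tr.action ∈ M.hidden
    · simp [hh]
    · simp [hh, h0 tr htr hh]
  · rintro ⟨h0, h⟩ l v
    simp only [edges, M.phases_of_mem_hidden ha, Finset.sum_product, Finset.sum_singleton, hta,
      List.nil_append]
    by_cases hl : l = []
    · subst hl
      simp only [if_true, ht, h, true_and]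
      congr 1
      refine Finset.sum_congr rfl fun tr htr => ?_
      by_cases hh : tr.action ∈ M.hidden
      · simp [hh]
      · simp [hh, h0 tr htr hh]
    · simp only [hl, Ne.symm hl, if_false, false_and, Finset.sum_const_zero, zero_add]
      refine Finset.sum_eq_zero fun tr htr => ?_
      by_cases hh : tr.action ∈ M.hidden
      · rw [(ht _).2 hh, if_neg (Ne.symm hl)]
      · simp [h0 tr htr hh]

/-- The traces `[]` and `[a]` are the layers of `state v` and `stateA v`. Hidden transitions stay in
a layer, transitions labelled `a` lead from the first to the second, and all other edges would
produce a forbidden trace. -/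
theorem isFlow_iff_of_notMem_hidden (ha : a ∉ M.hidden) :
    M.IsFlow a A init halt x ↔
      (∀ tr ∈ A, tr.action ∉ M.hidden → tr.action ≠ a → x ([], tr) = 0) ∧
      (∀ tr ∈ A, tr.action ∉ M.hidden → x ([a], tr) = 0) ∧
      (∀ v, open Classical in
        init v + ∑ tr ∈ A,
          (if tr.action ∈ M.hidden then x ([], tr) * (tr.target v).toNNReal else 0) =
        ∑ tr ∈ A, (if tr.action ∈ M.hidden ∧ tr.source = v then x ([], tr) else 0) +
        ∑ tr ∈ A, (if tr.action = a ∧ tr.source = v then x ([], tr) else 0)) ∧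
      ∀ v, open Classical in
        ∑ tr ∈ A, (if tr.action = a then x ([], tr) * (tr.target v).toNNReal else 0) +
        ∑ tr ∈ A, (if tr.action ∈ M.hidden then x ([a], tr) * (tr.target v).toNNReal else 0) =
        ∑ tr ∈ A, (if tr.action ∈ M.hidden ∧ tr.source = v then x ([a], tr) else 0) +
          halt v := by
  classical
  have hta : M.traceOf a = [a] := by simp [traceOf, ha]
  have ht : ∀ b, M.traceOf b = [] ↔ b ∈ M.hidden := fun b => by
    unfold traceOf; split_ifs with h <;> simp [h]
  have ht' : ∀ b, M.traceOf b = [a] ↔ b = a := fun b => by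
    unfold traceOf
    split_ifs with h
    · simp only [false_iff]
      rintro rfl
      exact ha h
    · simp
  have hap : ∀ b, [a] ++ M.traceOf b = [a] ↔ b ∈ M.hidden := fun b => by rw [← ht]; simp
  have hph : M.phases a = {[], [a]} := by rw [phases, hta]
  have hne : ([] : List Act) ∉ ({[a]} : Finset (List Act)) := by simp
  have hsplit : ∀ tr ∈ A, (tr.action ∉ M.hidden → tr.action ≠ a → x ([], tr) = 0) → ∀ v,
      (if tr.source = v then x ([], tr) else 0) =
        (if tr.action ∈ M.hidden ∧ tr.source = v then x ([], tr) else 0) +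
        (if tr.action = a ∧ tr.source = v then x ([], tr) else 0) := by
    intro tr htr h0 v
    by_cases h1 : tr.action ∈ M.hidden
    · have : tr.action ≠ a := fun h => ha (h ▸ h1)
      simp [h1, this]
    · by_cases h2 : tr.action = a
      · simp [h2, ha]
      · simp [h1, h2, h0 h1 h2]
  have hdrop : ∀ tr ∈ A, (tr.action ∉ M.hidden → x ([a], tr) = 0) → ∀ v,
      (if tr.source = v then x ([a], tr) else 0) =
        (if tr.action ∈ M.hidden ∧ tr.source = v then x ([a], tr) else 0) := by
    intro tr htr h0 v
    by_cases h1 : tr.action ∈ M.hidden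
    · simp [h1]
    · simp [h1, h0 h1]
  constructor
  · intro h
    have h0 : ∀ tr ∈ A, tr.action ∉ M.hidden → tr.action ≠ a → x ([], tr) = 0 :=
      fun tr htr h1 h2 => h.eq_zero (M.nil_mem_phases a) htr (by simp [hph, ht, ht', h1, h2])
    have h0' : ∀ tr ∈ A, tr.action ∉ M.hidden → x ([a], tr) = 0 :=
      fun tr htr h1 => h.eq_zero (by simp [hph]) htr (by simp [hph, ht, h1])
    refine ⟨h0, h0', fun v => ?_, fun v => ?_⟩
    · have h := h [] v
      simp only [edges, hph, Finset.sum_product, Finset.sum_insert hne, Finset.sum_singleton, hta,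
        ht, if_true, true_and, List.append_eq_nil_iff, List.cons_ne_nil,
        false_and, if_false, Finset.sum_const_zero, add_zero, List.nil_eq] at h
      rw [h, ← Finset.sum_add_distrib]
      exact Finset.sum_congr rfl fun tr htr => hsplit tr htr (h0 tr htr) v
    · have h := h [a] v
      simp only [edges, hph, Finset.sum_product, Finset.sum_insert hne, Finset.sum_singleton, hta,
        List.nil_append, ht', hap, if_true, true_and,
        List.cons_ne_nil, if_false, Finset.sum_const_zero, zero_add, List.nil_eq,
        false_and] at h
      rw [h]
      congr 1
      exact Finset.sum_congr rfl fun tr htr => hdrop tr htr (h0' tr htr) v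
  · rintro ⟨h0, h0', h1, h2⟩ l v
    by_cases hl : l = []
    · subst hl
      simp only [edges, hph, Finset.sum_product, Finset.sum_insert hne, Finset.sum_singleton, hta,
        ht, if_true, true_and, List.append_eq_nil_iff, List.cons_ne_nil,
        false_and, if_false, Finset.sum_const_zero, add_zero, List.nil_eq]
      rw [h1, ← Finset.sum_add_distrib]
      exact Finset.sum_congr rfl fun tr htr => (hsplit tr htr (h0 tr htr) v).symm
    · by_cases hl' : l = [a]
      · subst hl'
        simp only [edges, hph, Finset.sum_product, Finset.sum_insert hne, Finset.sum_singleton, hta,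
          List.nil_append, ht', hap, if_true, true_and,
          List.cons_ne_nil, if_false, Finset.sum_const_zero, zero_add, List.nil_eq,
          false_and]
        rw [h2]
        congr 1
        exact Finset.sum_congr rfl fun tr htr => (hdrop tr htr (h0' tr htr) v).symm
      -- At any other trace no edge starts, and the edges that end there carry no flow by the two
      -- vanishing conditions.
      · have hlt : l ≠ M.traceOf a := hta ▸ hl'
        rw [if_neg hl, if_neg hlt, zero_add, add_zero, Finset.sum_eq_zero, Finset.sum_eq_zero]
        · intro e he
          refine if_neg fun h => ?_
          have := (Finset.mem_product.1 he).1
          simp [hph, h.1, hl, hl'] at this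
        · rintro ⟨k, tr⟩ he
          have hk := Finset.mem_product.1 he
          simp only [hph, Finset.mem_insert, Finset.mem_singleton] at hk
          refine ite_eq_right_iff.2 fun h => ?_
          have hx : x (k, tr) = 0 := by
            rcases hk.1 with rfl | rfl
            · refine h0 tr hk.2 (fun hh => hl ?_) (fun hh => hl' ?_)
              · rw [← h, (ht _).2 hh]; rfl
              · rw [← h, (ht' _).2 hh]; rfl
            · refine h0' tr hk.2 fun hh => hl' ?_
              rw [← h, (ht _).2 hh]; rfl
          rw [hx, zero_mul]

end FlowEquations

end ProbAut

/-! ### Probabilities of equivalence classes. -/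

section ClassProb

variable {S : Type*}

theorem PMF.sum_toReal [Fintype S] (p : PMF S) : ∑ v, (p v).toReal = 1 := by
  have h := p.tsum_coe
  rw [tsum_fintype] at h
  rw [← ENNReal.toReal_sum fun v _ => PMF.apply_ne_top _ _, h, ENNReal.toReal_one]

open Classical in
theorem classProb_eq_sum [Fintype S] (R : Setoid S) (μ : PMF S) (C : Quotient R) :
    classProb R μ C = ∑ v with Quotient.mk R v = C, (μ v).toReal := by
  rw [classProb, tsum_fintype, ENNReal.toReal_sum fun v _ => PMF.apply_ne_top _ _]
  symm
  exact Finset.sum_subtype _ (by simp) _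

/-- A nonnegative function with the same class sums as a distribution is a distribution. -/
theorem exists_pmf_of_classProb [Finite S] (R : Setoid S) (μ : PMF S) (h : S → ℝ)
    (h0 : ∀ v, 0 ≤ h v)
    (hs : ∀ C, open Classical in ∑ᶠ v, (if Quotient.mk R v = C then h v else 0) =
      classProb R μ C) :
    ∃ ν : PMF S, (∀ v, (ν v).toReal = h v) ∧ ∀ C, classProb R ν C = classProb R μ C := by
  classical
  have := Fintype.ofFinite S
  have := Fintype.ofFinite (Quotient R)
  simp only [finsum_eq_sum_of_fintype] at hs
  have h1 : ∑ v, h v = 1 := by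
    -- Summing over all classes shows that `h` has the same total mass as `μ`.
    have := Finset.sum_congr (s₁ := (Finset.univ : Finset (Quotient R))) rfl fun C _ => hs C
    simp only [classProb_eq_sum, ← Finset.sum_filter] at this
    rwa [Finset.sum_fiberwise, Finset.sum_fiberwise, PMF.sum_toReal] at this
  refine ⟨PMF.ofFintype (fun v => ENNReal.ofReal (h v)) ?_, ?_, ?_⟩
  · rw [← ENNReal.ofReal_sum_of_nonneg fun v _ => h0 v, h1, ENNReal.ofReal_one]
  · intro v
    simp [ENNReal.toReal_ofReal (h0 v)]
  · intro C
    rw [← hs C, classProb_eq_sum, Finset.sum_filter]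
    refine Finset.sum_congr rfl fun v _ => ?_
    simp [ENNReal.toReal_ofReal (h0 v)]

end ClassProb

/-! ### Feasible points of the linear program and flows. -/

namespace ProbAut

variable {S Act : Type*} {M : ProbAut S Act} {t : S} {a : Act} {μ : PMF S}
  {A : Finset (Transition S Act)} {R : Setoid S} {f : M.Vertex R → M.Vertex R → ℝ}

theorem toReal_eq_zero_of_notMem_support {p : PMF S} {v : S} (h : v ∉ p.support) :
    (p v).toReal = 0 := by
  rw [(PMF.apply_eq_zero_iff _ _).2 h, ENNReal.toReal_zero]

open Classical in
theorem toReal_pure (t v : S) :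
    (PMF.pure t v).toReal = if v = t then 1 else 0 := by
  rw [PMF.pure_apply]
  split_ifs <;> simp

/-- This gives conservation at a transition vertex: the balanced outgoing values add up to the
incoming one. -/
theorem sum_support_mul [Fintype S] (p : PMF S) (r : ℝ) :
    (open Classical in ∑ v, if v ∈ p.support then (p v).toReal * r else 0) = r := by
  classical
  have h : ∀ v, (if v ∈ p.support then (p v).toReal * r else 0) = (p v).toReal * r := by
    intro v
    split_ifs with hv
    · rfl
    · rw [toReal_eq_zero_of_notMem_support hv, zero_mul]
  simp only [h]
  rw [← Finset.sum_mul, PMF.sum_toReal, one_mul]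

section

variable [Finite S]

/-- Conservation at a class vertex turns the sink constraint into a statement on the values of the
arcs entering the class, and these values form the halting distribution. -/
theorem LPFeasible.exists_halt (h : M.LPFeasible t a μ A R f) :
    ∃ ν : PMF S, (∀ v, (ν v).toReal = open Classical in if a ∈ M.hidden then
        f (.state v) (.cls (Quotient.mk R v)) else f (.stateA v) (.cls (Quotient.mk R v))) ∧
      ∀ C, classProb R ν C = classProb R μ C := by
  classical
  have := Fintype.ofFinite S
  have := Fintype.ofFinite M.Tr
  have := Fintype.ofFinite (Quotient R)
  refine exists_pmf_of_classProb R μ _ (fun v => ?_) (fun C => ?_)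
  · split_ifs with ha
    · exact h.nonneg _ _ (.halt v ha)
    · exact h.nonneg _ _ (.haltA v ha)
  · have hc := h.conservation (.cls C) trivial (by simp) (by simp)
    rw [inflow_cls, outflow_cls, h.sink, sub_eq_zero] at hc
    rw [← hc, finsum_eq_sum_of_fintype, Finset.sum_filter]
    refine Finset.sum_congr rfl fun v _ => ?_
    split_ifs with h1 h2 <;> simp [h1]

/-- The flow on an edge is the value of the arc into its transition vertex. By balance, the arcs out
of that vertex carry the flow times the target probabilities, so conservation at `state v` is the
flow equation. -/
theorem LPFeasible.exists_isFlow_of_mem_hidden (hA : ↑A ⊆ M.trans) (ha : a ∈ M.hidden)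
    (h : M.LPFeasible t a μ A R f) :
    ∃ (ν : PMF S) (x : List Act × Transition S Act → ℝ≥0),
      M.IsFlow a A (fun v => (PMF.pure t v).toNNReal) (fun v => (ν v).toNNReal) x ∧
      ∀ C, classProb R ν C = classProb R μ C := by
  classical
  have := Fintype.ofFinite S
  have := Fintype.ofFinite M.Tr
  have := Fintype.ofFinite (Quotient R)
  obtain ⟨ν, hν, hC⟩ := h.exists_halt
  let x : List Act × Transition S Act → ℝ≥0 := fun e => if hm : e.2 ∈ M.trans then
    if e.2.action ∈ M.hidden then (f (.state e.2.source) (.tr ⟨e.2, hm⟩)).toNNReal else 0 else 0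
  have hx : ∀ tr : M.Tr, tr.1 ∈ A → tr.1.action ∈ M.hidden →
      (x ([], tr.1) : ℝ) = f (.state tr.1.source) (.tr tr) := by
    intro tr htr hh
    simp only [x, tr.2, hh, dif_pos, if_true]
    exact Real.coe_toNNReal _ (h.nonneg _ _ (.intIn tr htr hh))
  refine ⟨ν, x, (isFlow_iff_of_mem_hidden ha).2 ⟨fun tr _ hh => by simp [x, hh], fun v => ?_⟩, hC⟩
  have hc := h.conservation (.state v) trivial (by simp) (by simp)
  rw [inflow_state, outflow_state, sub_eq_zero] at hc
  rw [← NNReal.coe_inj]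
  push_cast
  rw [toReal_pure, hν, if_pos ha]
  simp only [ha, not_true, false_and, if_false, Finset.sum_const_zero, add_zero, if_true] at hc
  have hs : (if v = t then f .source (.state v) else 0) = if v = t then 1 else 0 := by
    split_ifs with hv
    · rw [hv, h.source]
    · rfl
  rw [hs, sum_tr_eq hA (g := fun tr => ((if tr.action ∈ M.hidden then
      x ([], tr) * (tr.target v).toNNReal else 0 : ℝ≥0) : ℝ)),
    sum_tr_eq hA (g := fun tr => ((if tr.action ∈ M.hidden ∧ tr.source = v then
      x ([], tr) else 0 : ℝ≥0) : ℝ))] at hc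
  · rw [hc, add_comm]
  · intro tr
    by_cases htr : tr.1 ∈ A
    · by_cases hh : tr.1.action ∈ M.hidden
      · by_cases hv : tr.1.source = v
        · subst hv
          simp [htr, hh, hx]
        · simp [hv]
      · simp [hh]
    · simp [htr]
  · intro tr
    by_cases htr : tr.1 ∈ A
    · by_cases hh : tr.1.action ∈ M.hidden
      · by_cases hv : v ∈ tr.1.target.support
        · have := h.balance tr htr hh v hv
          rw [if_pos ⟨htr, hh, hv⟩, if_pos htr, if_pos hh, NNReal.coe_mul, hx tr htr hh,
            ENNReal.coe_toNNReal_eq_toReal]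
          linarith
        · rw [if_neg fun h => hv h.2.2, if_pos htr, if_pos hh, NNReal.coe_mul,
            ENNReal.coe_toNNReal_eq_toReal, toReal_eq_zero_of_notMem_support hv, mul_zero]
      · simp [hh]
    · simp [htr]

theorem LPFeasible.exists_isFlow_of_notMem_hidden (hA : ↑A ⊆ M.trans) (ha : a ∉ M.hidden)
    (h : M.LPFeasible t a μ A R f) :
    ∃ (ν : PMF S) (x : List Act × Transition S Act → ℝ≥0),
      M.IsFlow a A (fun v => (PMF.pure t v).toNNReal) (fun v => (ν v).toNNReal) x ∧
      ∀ C, classProb R ν C = classProb R μ C := by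
  classical
  have := Fintype.ofFinite S
  have := Fintype.ofFinite M.Tr
  have := Fintype.ofFinite (Quotient R)
  obtain ⟨ν, hν, hC⟩ := h.exists_halt
  -- The arc into the transition vertex determines the trace: hidden transitions have one arc in
  -- each layer, and a transition labelled `a` is used at trace `[]` although its vertex is `trA`.
  let x : List Act × Transition S Act → ℝ≥0 := fun e => if hm : e.2 ∈ M.trans then
    if e.1 = [] then
      if e.2.action ∈ M.hidden then (f (.state e.2.source) (.tr ⟨e.2, hm⟩)).toNNReal else
      if e.2.action = a then (f (.state e.2.source) (.trA ⟨e.2, hm⟩)).toNNReal else 0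
    else if e.2.action ∈ M.hidden then (f (.stateA e.2.source) (.trA ⟨e.2, hm⟩)).toNNReal else 0
    else 0
  have hx1 : ∀ tr : M.Tr, tr.1 ∈ A → tr.1.action ∈ M.hidden →
      (x ([], tr.1) : ℝ) = f (.state tr.1.source) (.tr tr) := by
    intro tr htr hh
    simp only [x, tr.2, hh, dif_pos, if_true]
    exact Real.coe_toNNReal _ (h.nonneg _ _ (.intIn tr htr hh))
  have hx2 : ∀ tr : M.Tr, tr.1 ∈ A → tr.1.action = a →
      (x ([], tr.1) : ℝ) = f (.state tr.1.source) (.trA tr) := by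
    intro tr htr hh
    simp only [x, tr.2, hh, ha, dif_pos, if_true, if_false]
    exact Real.coe_toNNReal _ (h.nonneg _ _ (.extIn tr ha htr hh))
  have hx3 : ∀ tr : M.Tr, tr.1 ∈ A → tr.1.action ∈ M.hidden →
      (x ([a], tr.1) : ℝ) = f (.stateA tr.1.source) (.trA tr) := by
    intro tr htr hh
    simp only [x, tr.2, hh, dif_pos, if_true, List.cons_ne_nil, if_false]
    exact Real.coe_toNNReal _ (h.nonneg _ _ (.intInA tr ha htr hh))
  refine ⟨ν, x, (isFlow_iff_of_notMem_hidden ha).2 ⟨fun tr _ hh hh' => by simp [x, hh, hh'],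
    fun tr _ hh => by simp [x, hh], fun v => ?_, fun v => ?_⟩, hC⟩
  · have hc := h.conservation (.state v) trivial (by simp) (by simp)
    rw [inflow_state, outflow_state, sub_eq_zero] at hc
    rw [← NNReal.coe_inj]
    push_cast
    rw [toReal_pure]
    simp only [ha, not_false_eq_true, true_and, if_false, zero_add] at hc
    have hs : (if v = t then f .source (.state v) else 0) = if v = t then 1 else 0 := by
      split_ifs with hv
      · rw [hv, h.source]
      · rfl
    rw [hs, sum_tr_eq hA (g := fun tr => ((if tr.action ∈ M.hidden then
        x ([], tr) * (tr.target v).toNNReal else 0 : ℝ≥0) : ℝ)),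
      sum_tr_eq hA (g := fun tr => ((if tr.action ∈ M.hidden ∧ tr.source = v then
        x ([], tr) else 0 : ℝ≥0) : ℝ)),
      sum_tr_eq hA (g := fun tr => ((if tr.action = a ∧ tr.source = v then
        x ([], tr) else 0 : ℝ≥0) : ℝ))] at hc
    · exact hc
    · intro tr
      by_cases htr : tr.1 ∈ A
      · by_cases hh : tr.1.action = a
        · by_cases hv : tr.1.source = v
          · rw [if_pos ⟨htr, hh, hv⟩, if_pos htr, if_pos ⟨hh, hv⟩, hx2 tr htr hh, hv]
          · simp [hv]
        · simp [hh]
      · simp [htr]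
    · intro tr
      by_cases htr : tr.1 ∈ A
      · by_cases hh : tr.1.action ∈ M.hidden
        · by_cases hv : tr.1.source = v
          · rw [if_pos ⟨htr, hh, hv⟩, if_pos htr, if_pos ⟨hh, hv⟩, hx1 tr htr hh, hv]
          · simp [hv]
        · simp [hh]
      · simp [htr]
    · intro tr
      by_cases htr : tr.1 ∈ A
      · by_cases hh : tr.1.action ∈ M.hidden
        · by_cases hv : v ∈ tr.1.target.support
          · have := h.balance tr htr hh v hv
            rw [if_pos ⟨htr, hh, hv⟩, if_pos htr, if_pos hh, NNReal.coe_mul, hx1 tr htr hh,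
              ENNReal.coe_toNNReal_eq_toReal]
            linarith
          · rw [if_neg fun h => hv h.2.2, if_pos htr, if_pos hh, NNReal.coe_mul,
              ENNReal.coe_toNNReal_eq_toReal, toReal_eq_zero_of_notMem_support hv, mul_zero]
        · simp [hh]
      · simp [htr]
  · have hc := h.conservation (.stateA v) ha (by simp) (by simp)
    rw [inflow_stateA, outflow_stateA, sub_eq_zero] at hc
    rw [← NNReal.coe_inj, ← Finset.sum_add_distrib]
    push_cast
    rw [hν, if_neg ha]
    simp only [ha, not_false_eq_true, true_and, if_true] at hc
    rw [sum_tr_eq hA (g := fun tr => ((if tr.action = a then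
        x ([], tr) * (tr.target v).toNNReal else 0 : ℝ≥0) : ℝ) + ((if tr.action ∈ M.hidden then
        x ([a], tr) * (tr.target v).toNNReal else 0 : ℝ≥0) : ℝ)),
      sum_tr_eq hA (g := fun tr => ((if tr.action ∈ M.hidden ∧ tr.source = v then
        x ([a], tr) else 0 : ℝ≥0) : ℝ))] at hc
    · rw [hc, add_comm]
    · intro tr
      by_cases htr : tr.1 ∈ A
      · by_cases hh : tr.1.action ∈ M.hidden
        · by_cases hv : tr.1.source = v
          · rw [if_pos ⟨htr, hh, hv⟩, if_pos htr, if_pos ⟨hh, hv⟩, hx3 tr htr hh, hv]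
          · simp [hv]
        · simp [hh]
      · simp [htr]
    · intro tr
      by_cases htr : tr.1 ∈ A
      · by_cases hv : v ∈ tr.1.target.support
        · by_cases hh : tr.1.action ∈ M.hidden
          · have := h.balanceA ha tr htr hh v hv
            have hne : tr.1.action ≠ a := fun h => ha (h ▸ hh)
            rw [if_pos ⟨htr, .inl hh, hv⟩, if_pos htr, if_neg hne, if_pos hh, NNReal.coe_mul,
              hx3 tr htr hh, ENNReal.coe_toNNReal_eq_toReal, NNReal.coe_zero]
            linarith
          · by_cases hh' : tr.1.action = a
            · have := h.balanceExt ha tr htr hh' v hv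
              rw [if_pos ⟨htr, .inr hh', hv⟩, if_pos htr, if_pos hh', if_neg hh, NNReal.coe_mul,
                hx2 tr htr hh', ENNReal.coe_toNNReal_eq_toReal, NNReal.coe_zero]
              linarith
            · simp [hh, hh']
        · have h0 : tr.1.target v = 0 := (PMF.apply_eq_zero_iff _ _).2 hv
          simp [h0]
      · simp [htr]

/-- The point of the linear programming problem that is given by a flow. -/
def lpPoint (M : ProbAut S Act) (a : Act) (μ : PMF S) (R : Setoid S) (ν : PMF S)
    (x : List Act × Transition S Act → ℝ≥0) : M.Vertex R → M.Vertex R → ℝ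
  | .source, .state _ => 1
  | .cls C, .sink => classProb R μ C
  | .state v, .cls _ => (ν v).toReal
  | .stateA v, .cls _ => (ν v).toReal
  | .state _, .tr tr => x ([], tr.1)
  | .state _, .trA tr => x ([], tr.1)
  | .stateA _, .trA tr => x ([a], tr.1)
  | .tr tr, .state v => (tr.1.target v).toReal * x ([], tr.1)
  -- A vertex `trA` of the network is entered by a single arc: from the first layer if the label is
  -- `a`, from the second if it is hidden.
  | .trA tr, .stateA v => (tr.1.target v).toReal *
      open Classical in if tr.1.action = a then (x ([], tr.1) : ℝ) else x ([a], tr.1)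
  | _, _ => 0

/-- Conservation holds at state vertices by the flow equations, at transition vertices because
target probabilities sum to one, and at class vertices because `ν` and `μ` have equal class
probabilities. -/
theorem IsFlow.lpFeasible (hA : ↑A ⊆ M.trans) {ν : PMF S}
    {x : List Act × Transition S Act → ℝ≥0}
    (h : M.IsFlow a A (fun v => (PMF.pure t v).toNNReal) (fun v => (ν v).toNNReal) x)
    (hC : ∀ C, classProb R ν C = classProb R μ C) :
    M.LPFeasible t a μ A R (lpPoint M a μ R ν x) := by
  classical
  have := Fintype.ofFinite S
  have := Fintype.ofFinite M.Tr
  have := Fintype.ofFinite (Quotient R)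
  refine ⟨?_, rfl, fun C => rfl, ?_, ?_, ?_, ?_⟩
  · rintro u v -
    unfold lpPoint
    split <;> first | positivity | exact ENNReal.toReal_nonneg
  · rintro (_ | _ | v | tr | v | tr | C) hv h1 h2
    · exact absurd rfl h1
    · exact absurd rfl h2
    · rw [inflow_state, outflow_state, sub_eq_zero]
      simp only [lpPoint]
      by_cases ha : a ∈ M.hidden
      · have h := congrArg NNReal.toReal (((isFlow_iff_of_mem_hidden ha).1 h).2 v)
        push_cast at h
        rw [toReal_pure] at h
        simp only [ha, not_true, false_and, if_false, Finset.sum_const_zero, add_zero, if_true]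
        rw [sum_tr_eq hA (g := fun tr => ((if tr.action ∈ M.hidden then
            x ([], tr) * (tr.target v).toNNReal else 0 : ℝ≥0) : ℝ)),
          sum_tr_eq hA (g := fun tr => ((if tr.action ∈ M.hidden ∧ tr.source = v then
            x ([], tr) else 0 : ℝ≥0) : ℝ))]
        · rw [h, add_comm]
        · intro tr
          split_ifs <;> simp_all
        · intro tr
          split_ifs <;> simp_all [mul_comm]
          exact .inl rfl
      · have h := congrArg NNReal.toReal (((isFlow_iff_of_notMem_hidden ha).1 h).2.2.1 v)
        push_cast at h
        rw [toReal_pure] at h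
        simp only [ha, not_false_eq_true, true_and, if_false, zero_add]
        rw [sum_tr_eq hA (g := fun tr => ((if tr.action ∈ M.hidden then
            x ([], tr) * (tr.target v).toNNReal else 0 : ℝ≥0) : ℝ)),
          sum_tr_eq hA (g := fun tr => ((if tr.action ∈ M.hidden ∧ tr.source = v then
            x ([], tr) else 0 : ℝ≥0) : ℝ)),
          sum_tr_eq hA (g := fun tr => ((if tr.action = a ∧ tr.source = v then
            x ([], tr) else 0 : ℝ≥0) : ℝ))]
        · exact h
        · intro tr
          split_ifs <;> simp_all
        · intro tr
          split_ifs <;> simp_all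
        · intro tr
          split_ifs <;> simp_all [mul_comm]
          exact .inl rfl
    · rw [inflow_tr, outflow_tr, sub_eq_zero]
      simp only [lpPoint]
      split_ifs with hc
      · simp only [hc, true_and]
        exact (sum_support_mul _ _).symm
      · rw [Finset.sum_eq_zero]
        intro v _
        exact if_neg fun h => hc ⟨h.1, h.2.1⟩
    · have ha : a ∉ M.hidden := hv
      rw [inflow_stateA, outflow_stateA, sub_eq_zero]
      simp only [lpPoint]
      have h := congrArg NNReal.toReal (((isFlow_iff_of_notMem_hidden ha).1 h).2.2.2 v)
      rw [← Finset.sum_add_distrib] at h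
      push_cast at h
      simp only [ha, not_false_eq_true, true_and, if_true]
      rw [sum_tr_eq hA (g := fun tr => ((if tr.action = a then
          x ([], tr) * (tr.target v).toNNReal else 0 : ℝ≥0) : ℝ) + ((if tr.action ∈ M.hidden then
          x ([a], tr) * (tr.target v).toNNReal else 0 : ℝ≥0) : ℝ)),
        sum_tr_eq hA (g := fun tr => ((if tr.action ∈ M.hidden ∧ tr.source = v then
          x ([a], tr) else 0 : ℝ≥0) : ℝ))]
      · rw [h, add_comm]
      · intro tr
        split_ifs <;> simp_all
      · intro tr
        by_cases htr : tr.1 ∈ A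
        · by_cases hv : v ∈ tr.1.target.support
          · by_cases hh : tr.1.action = a
            · have : tr.1.action ∉ M.hidden := hh ▸ ha
              rw [if_pos ⟨htr, .inr hh, hv⟩, if_pos hh, if_pos htr, if_pos hh, if_neg this]
              simp [mul_comm]
              exact .inl rfl
            · by_cases hh' : tr.1.action ∈ M.hidden
              · simp [htr, hv, hh, hh', mul_comm]
                exact .inl rfl
              · simp [hh, hh']
          · have h0 : tr.1.target v = 0 := (PMF.apply_eq_zero_iff _ _).2 hv
            simp [h0]
        · simp [htr]
    · obtain ⟨ha, htr, hh⟩ := hv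
      rw [inflow_trA, outflow_trA, sub_eq_zero]
      simp only [lpPoint, ha, htr, not_false_eq_true, true_and, hh.symm]
      rw [sum_support_mul]
      by_cases hh' : tr.1.action = a
      · have : tr.1.action ∉ M.hidden := hh' ▸ ha
        rw [if_pos hh', if_neg this, if_pos hh', add_zero]
      · rw [if_neg hh', if_pos (hh.resolve_left hh'), if_neg hh', zero_add]
    · rw [inflow_cls, outflow_cls, sub_eq_zero]
      simp only [lpPoint, ite_self]
      rw [← hC, classProb_eq_sum]
  · intro tr htr hh v hv
    simp [lpPoint]
  · intro ha tr htr hh v hv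
    have : tr.1.action ≠ a := fun h => ha (h ▸ hh)
    simp [lpPoint, this]
  · intro ha tr htr hh v hv
    simp [lpPoint, hh]

theorem exists_lpFeasible_iff (hA : ↑A ⊆ M.trans) :
    (∃ f, M.LPFeasible t a μ A R f) ↔
    ∃ (ν : PMF S) (x : List Act × Transition S Act → ℝ≥0),
      M.IsFlow a A (fun v => (PMF.pure t v).toNNReal) (fun v => (ν v).toNNReal) x ∧
      ∀ C, classProb R ν C = classProb R μ C := by
  constructor
  · rintro ⟨f, hf⟩
    by_cases ha : a ∈ M.hidden
    · exact hf.exists_isFlow_of_mem_hidden hA ha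
    · exact hf.exists_isFlow_of_notMem_hidden hA ha
  · rintro ⟨ν, x, hx, hC⟩
    exact ⟨_, hx.lpFeasible hA hC⟩

end

end ProbAut

/-! ### Lifting an equivalence relation to distributions. -/

section Lifting

variable {S : Type*}

/-- A weighting puts no mass between different classes, so on each class both marginals have the
mass of the same block. Conversely, on each class the product of the two distributions divided by
the class mass is a weighting. -/
theorem lifting_setoid_iff [Finite S] (R : Setoid S) (μ ν : PMF S) :
    Lifting R.r μ ν ↔ ∀ C, classProb R μ C = classProb R ν C := by
  classical
  have := Fintype.ofFinite S
  have hm : ∀ C, classProb R μ C = classProb R ν C ↔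
      ∑ v with Quotient.mk R v = C, μ v = ∑ v with Quotient.mk R v = C, ν v := by
    intro C
    have hne : ∀ p : PMF S, ∑ v with Quotient.mk R v = C, p v ≠ ∞ := fun p =>
      ENNReal.sum_ne_top.2 fun v _ => PMF.apply_ne_top _ _
    rw [classProb_eq_sum, classProb_eq_sum, ← ENNReal.toReal_sum fun v _ => PMF.apply_ne_top _ _,
      ← ENNReal.toReal_sum fun v _ => PMF.apply_ne_top _ _, ENNReal.toReal_eq_toReal_iff' (hne μ)
        (hne ν)]
  simp only [hm]
  constructor
  · rintro ⟨w, -, hR, h1, h2⟩ C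
    simp only [tsum_fintype] at h1 h2
    have hz : ∀ x y, ¬ R x y → w x y = 0 := fun x y h => by
      by_contra hne
      exact h (hR x y (pos_iff_ne_zero.2 hne))
    have e1 : ∀ x ∈ Finset.univ.filter (fun v => Quotient.mk R v = C),
        μ x = ∑ y with Quotient.mk R y = C, w x y := by
      intro x hx
      rw [← h1, Finset.sum_filter]
      refine Finset.sum_congr rfl fun y _ => ?_
      split_ifs with hy
      · rfl
      · refine hz x y fun h => hy ?_
        rw [← (Finset.mem_filter.1 hx).2]
        exact (Quotient.sound h).symm
    have e2 : ∀ y ∈ Finset.univ.filter (fun v => Quotient.mk R v = C),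
        ν y = ∑ x with Quotient.mk R x = C, w x y := by
      intro y hy
      rw [← h2, Finset.sum_filter]
      refine Finset.sum_congr rfl fun x _ => ?_
      split_ifs with hx
      · rfl
      · refine hz x y fun h => hx ?_
        rw [← (Finset.mem_filter.1 hy).2]
        exact Quotient.sound h
    rw [Finset.sum_congr rfl e1, Finset.sum_congr rfl e2, Finset.sum_comm]
  · intro h
    set m : Quotient R → ℝ≥0∞ := fun C => ∑ v with Quotient.mk R v = C, μ v with hmdef
    have hmt : ∀ C, m C ≠ ∞ := fun C => ENNReal.sum_ne_top.2 fun v _ => PMF.apply_ne_top _ _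
    have hμ : ∀ x, m (Quotient.mk R x) = 0 → μ x = 0 := fun x h0 =>
      Finset.sum_eq_zero_iff.1 h0 x (by simp)
    have hν : ∀ x, m (Quotient.mk R x) = 0 → ν x = 0 := fun x h0 => by
      simp only [hmdef, h] at h0
      exact Finset.sum_eq_zero_iff.1 h0 x (by simp)
    -- On a class of mass zero both distributions vanish, and the convention `0 / 0 = 0` gives the
    -- right value.
    let w : S → S → ℝ≥0∞ := fun x y =>
      if Quotient.mk R x = Quotient.mk R y then μ x * ν y / m (Quotient.mk R x) else 0
    have h1 : ∀ x, ∑' y, w x y = μ x := by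
      intro x
      simp only [w, tsum_fintype, div_eq_mul_inv]
      rw [← Finset.sum_filter, ← Finset.sum_mul, ← Finset.mul_sum]
      have : ∑ y with Quotient.mk R x = Quotient.mk R y, ν y = m (Quotient.mk R x) := by
        rw [hmdef]
        simp only [h]
        exact Finset.sum_congr (Finset.filter_congr fun _ _ => eq_comm) fun _ _ => rfl
      rw [this, mul_assoc]
      by_cases h0 : m (Quotient.mk R x) = 0
      · rw [hμ x h0, zero_mul]
      · rw [ENNReal.mul_inv_cancel h0 (hmt _), mul_one]
    have h2 : ∀ y, ∑' x, w x y = ν y := by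
      intro y
      simp only [tsum_fintype]
      have : ∀ x, w x y =
          if Quotient.mk R x = Quotient.mk R y then μ x * (ν y / m (Quotient.mk R y)) else 0 := by
        intro x
        simp only [w]
        split_ifs with hxy
        · rw [hxy, mul_div_assoc]
        · rfl
      simp only [this]
      rw [← Finset.sum_filter, ← Finset.sum_mul]
      change m (Quotient.mk R y) * _ = _
      by_cases h0 : m (Quotient.mk R y) = 0
      · rw [h0, hν y h0, zero_mul]
      · rw [ENNReal.mul_div_cancel h0 (hmt _)]
    refine ⟨w, fun x y => ?_, fun x y hxy => ?_, h1, h2⟩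
    · exact ((ENNReal.le_tsum y).trans_eq (h1 x)).trans (PMF.coe_le_one _ _)
    · by_contra hn
      have : Quotient.mk R x ≠ Quotient.mk R y := fun h => hn (Quotient.exact h)
      simp [w, this] at hxy

/-- The weighting lives on the diagonal, so both marginals are its diagonal values. -/
theorem eq_of_lifting_eq {μ ν : PMF S} (h : Lifting (fun x y : S => x = y) μ ν) : ν = μ := by
  obtain ⟨w, -, hR, h1, h2⟩ := h
  have hz : ∀ x y, x ≠ y → w x y = 0 := fun x y hne => by
    by_contra h0
    exact hne (hR x y (pos_iff_ne_zero.2 h0))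
  ext x
  rw [← h1, ← h2, tsum_eq_single x fun y hy => hz y x hy, tsum_eq_single x fun y hy => hz x y hy.symm]

end Lifting

/-! ### Adjoining the fresh state. -/

section Extension

variable {S : Type*}

@[simp]
theorem extDist_some (μ : PMF S) (v : S) : extDist μ (some v) = μ v := by
  classical
  rw [extDist, PMF.map_apply, tsum_eq_single v]
  · simp
  · intro w hw
    simp [hw.symm]

@[simp]
theorem extDist_none (μ : PMF S) : extDist μ none = 0 := by
  simp [extDist, PMF.map_apply]

theorem extDist_injective : Function.Injective (extDist (S := S)) := fun μ ν h => by
  ext v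
  rw [← extDist_some μ, h, extDist_some]

theorem exists_eq_extDist {p : PMF (Option S)} (hp : p none = 0) : ∃ ν : PMF S, p = extDist ν := by
  have h := p.tsum_coe
  rw [← (Equiv.optionEquivSumPUnit.{0} S).symm.tsum_eq,
    Summable.tsum_sum ENNReal.summable ENNReal.summable] at h
  simp only [Equiv.optionEquivSumPUnit_symm_inl, Equiv.optionEquivSumPUnit_symm_inr, hp,
    tsum_zero, add_zero] at h
  let ν : PMF S := ⟨fun v => p (some v), (Summable.hasSum_iff ENNReal.summable).2 h⟩
  refine ⟨ν, ?_⟩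
  ext (_ | v)
  · rw [hp, extDist_none]
  · rw [extDist_some]
    rfl

theorem extSetoid_mk_some_eq_iff (R : Setoid S) (v w : S) :
    Quotient.mk (extSetoid R) (some v) = Quotient.mk (extSetoid R) (some w) ↔
      Quotient.mk R v = Quotient.mk R w := by
  rw [Quotient.eq, Quotient.eq]
  constructor
  · rintro (h | _)
    exact h
  · exact fun h => .some h

theorem extSetoid_mk_some_ne (R : Setoid S) (v : S) :
    Quotient.mk (extSetoid R) (some v) ≠ Quotient.mk (extSetoid R) none := by
  rw [Ne, Quotient.eq]
  rintro (_ | _)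

theorem classProb_extSetoid_none [Finite S] (R : Setoid S) (p : PMF (Option S)) :
    classProb (extSetoid R) p (Quotient.mk _ none) = (p none).toReal := by
  classical
  have := Fintype.ofFinite S
  rw [classProb_eq_sum, Finset.sum_filter, Fintype.sum_option]
  simp [extSetoid_mk_some_ne]

theorem classProb_extSetoid_some [Finite S] (R : Setoid S) (ν : PMF S) (v : S) :
    classProb (extSetoid R) (extDist ν) (Quotient.mk _ (some v)) =
      classProb R ν (Quotient.mk R v) := by
  classical
  have := Fintype.ofFinite S
  rw [classProb_eq_sum, classProb_eq_sum, Finset.sum_filter, Finset.sum_filter, Fintype.sum_option]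
  simp [extSetoid_mk_some_eq_iff]

/-- The fresh state is a class by itself, and `extDist μ` gives it mass zero. Hence `p` lives on
`S`, where the classes are those of `R`. -/
theorem forall_classProb_extSetoid_iff [Finite S] (R : Setoid S) (p : PMF (Option S)) (μ : PMF S) :
    (∀ C, classProb (extSetoid R) p C = classProb (extSetoid R) (extDist μ) C) ↔
      ∃ ν, p = extDist ν ∧ ∀ C, classProb R ν C = classProb R μ C := by
  constructor
  · intro h
    have h0 := h (Quotient.mk _ none)
    rw [classProb_extSetoid_none, classProb_extSetoid_none, extDist_none, ENNReal.toReal_zero,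
      ENNReal.toReal_eq_zero_iff] at h0
    obtain ⟨ν, rfl⟩ := exists_eq_extDist (h0.resolve_right (PMF.apply_ne_top _ _))
    refine ⟨ν, rfl, fun C => ?_⟩
    induction C using Quotient.inductionOn with
    | h v => rw [← classProb_extSetoid_some, h, classProb_extSetoid_some]
  · rintro ⟨ν, rfl, h⟩ C
    induction C using Quotient.inductionOn with
    | h v =>
      cases v with
      | none => simp [classProb_extSetoid_none]
      | some v => rw [classProb_extSetoid_some, classProb_extSetoid_some, h]

theorem Transition.ext_injective {Act : Type*} :
    Function.Injective (Transition.ext (S := S) (Act := Act)) := by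
  rintro ⟨s, a, p⟩ ⟨s', a', p'⟩ h
  simp only [Transition.ext, Transition.mk.injEq, Option.some.injEq] at h
  obtain ⟨rfl, rfl, h⟩ := h
  rw [extDist_injective h]

end Extension

namespace ProbAut

section FlowExtension

variable {S Act : Type*} {M : ProbAut S Act} {τ a : Act} {ρ ν : PMF S}
  {A : Finset (Transition S Act)}

open Classical in
/-- The set of transitions `A` together with the fresh transition, as a finite set. -/
def extFinset (A : Finset (Transition S Act)) (τ : Act) (ρ : PMF S) :
    Finset (Transition (Option S) Act) :=
  insert (freshTransition τ ρ) (A.image Transition.ext)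

theorem coe_extFinset (A : Finset (Transition S Act)) (τ : Act) (ρ : PMF S) :
    (extFinset A τ ρ : Set (Transition (Option S) Act)) = extTrans A τ ρ := by
  simp [extFinset, extTrans]

theorem sum_edges_extend (g : List Act × Transition (Option S) Act → ℝ≥0) :
    ∑ e ∈ (M.extend τ ρ).edges a (extFinset A τ ρ), g e =
      ∑ k ∈ M.phases a, g (k, freshTransition τ ρ) +
        ∑ e ∈ M.edges a A, g (e.1, e.2.ext) := by
  classical
  have hn : freshTransition τ ρ ∉ A.image Transition.ext := by
    simp [freshTransition, Transition.ext]
  rw [edges, edges, Finset.sum_product, Finset.sum_product, ← Finset.sum_add_distrib]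
  refine Finset.sum_congr rfl fun k _ => ?_
  rw [extFinset, Finset.sum_insert hn, Finset.sum_image Transition.ext_injective.injOn]

/-- No transition leads to `none`, and the fresh one is the only one leaving it. Conservation there
forces one unit along it at trace `[]` and nothing at other traces. As `τ` is hidden, this unit
arrives at trace `[]` distributed as `ρ`, replacing the source term. -/
theorem isFlow_extend_iff (hτ : τ ∈ M.hidden)
    {x : List Act × Transition (Option S) Act → ℝ≥0} :
    (M.extend τ ρ).IsFlow a (extFinset A τ ρ) (fun v => (PMF.pure none v).toNNReal)
        (fun v => (extDist ν v).toNNReal) x ↔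
      (∀ l ∈ M.phases a,
        x (l, freshTransition τ ρ) = open Classical in if l = [] then 1 else 0) ∧
      M.IsFlow a A (fun v => (ρ v).toNNReal) (fun v => (ν v).toNNReal)
        (fun e => x (e.1, e.2.ext)) := by
  classical
  have htr : ∀ b, (M.extend τ ρ).traceOf b = M.traceOf b := fun b => rfl
  have hτ' : M.traceOf τ = [] := by simp [traceOf, hτ]
  unfold IsFlow
  simp only [sum_edges_extend, htr, Option.forall, extDist_none, extDist_some, Transition.ext,
    freshTransition, hτ', List.append_nil, PMF.pure_apply, if_true, ENNReal.toNNReal_one,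
    ENNReal.toNNReal_zero, mul_zero, ite_self, Finset.sum_const_zero, add_zero, reduceCtorEq,
    and_false, and_true, if_false, Option.some.injEq, zero_add, Finset.sum_ite_eq']
  constructor
  · intro h
    have h0 : ∀ l ∈ M.phases a, x (l, ⟨none, τ, extDist ρ⟩) = if l = [] then 1 else 0 := by
      intro l hl
      rw [(h l).1, if_pos hl]
    refine ⟨h0, fun l v => ?_⟩
    rw [← (h l).2 v]
    congr 1
    by_cases hl : l ∈ M.phases a
    · rw [if_pos hl, h0 l hl]
      split_ifs <;> simp
    · rw [if_neg hl, if_neg]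
      rintro rfl
      exact hl (M.nil_mem_phases a)
  · rintro ⟨h0, h⟩ l
    refine ⟨?_, fun v => ?_⟩
    · split_ifs with h1 h2 h2
      · rw [h0 l h2, if_pos h1]
      · exact absurd (h1 ▸ M.nil_mem_phases a) h2
      · simp [h0 l h2, h1]
      · rfl
    · rw [← h l v]
      congr 1
      by_cases hl : l ∈ M.phases a
      · rw [if_pos hl, h0 l hl]
        split_ifs <;> simp
      · rw [if_neg hl, if_neg]
        rintro rfl
        exact hl (M.nil_mem_phases a)

theorem exists_isFlow_extend_iff [Finite S] (hτ : τ ∈ M.hidden) {R : Setoid S} {μ : PMF S} :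
    (∃ (p : PMF (Option S)) (x : List Act × Transition (Option S) Act → ℝ≥0),
      (M.extend τ ρ).IsFlow a (extFinset A τ ρ) (fun v => (PMF.pure none v).toNNReal)
        (fun v => (p v).toNNReal) x ∧
      ∀ C, classProb (extSetoid R) p C = classProb (extSetoid R) (extDist μ) C) ↔
    ∃ (ν : PMF S) (x : List Act × Transition S Act → ℝ≥0),
      M.IsFlow a A (fun v => (ρ v).toNNReal) (fun v => (ν v).toNNReal) x ∧
      ∀ C, classProb R ν C = classProb R μ C := by
  classical
  simp only [forall_classProb_extSetoid_iff]
  constructor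
  · rintro ⟨_, x, hx, ν, rfl, hC⟩
    exact ⟨ν, _, ((isFlow_extend_iff hτ).1 hx).2, hC⟩
  · rintro ⟨ν, x, hx, hC⟩
    -- The default value off the range of `Transition.ext` is the flow forced on the fresh
    -- transition.
    let y : List Act × Transition (Option S) Act → ℝ≥0 := fun e =>
      Function.extend Transition.ext (fun tr => x (e.1, tr)) (fun _ => if e.1 = [] then 1 else 0) e.2
    refine ⟨extDist ν, y, (isFlow_extend_iff hτ).2 ⟨fun l _ => ?_, ?_⟩, ν, rfl, hC⟩
    · refine Function.extend_apply' _ _ _ ?_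
      rintro ⟨tr, h⟩
      simp [Transition.ext, freshTransition] at h
    · convert hx using 1
      ext e
      simp only [y, Transition.ext_injective.extend_apply]

end FlowExtension

/-! ### Existence of optimal points. -/

section Optimal

variable {S Act : Type*} [Finite S] {M : ProbAut S Act} {t : S} {a : Act} {μ : PMF S}
  {A : Set (Transition S Act)} {R : Setoid S} {f : M.Vertex R → M.Vertex R → ℝ}

theorem isClosed_lpFeasible : IsClosed {f | M.LPFeasible t a μ A R f} := by
  classical
  have h : {f | M.LPFeasible t a μ A R f} =
      (⋂ (u) (v) (_ : M.Arc t a A R u v), {f | 0 ≤ f u v}) ∩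
      {f | f .source (.state t) = 1} ∩
      (⋂ C, {f | f (.cls C) .sink = classProb R μ C}) ∩
      (⋂ (v) (_ : M.IsVertex a A R v) (_ : v ≠ .source) (_ : v ≠ .sink),
        {f | ∑ u with M.Arc t a A R u v, f u v - ∑ u with M.Arc t a A R v u, f v u = 0}) ∩
      (⋂ (tr : M.Tr) (_ : tr.1 ∈ A) (_ : tr.1.action ∈ M.hidden) (v') (_ : v' ∈ tr.1.target.support),
        {f | f (.tr tr) (.state v') -
          (tr.1.target v').toReal * f (.state tr.1.source) (.tr tr) = 0}) ∩
      (⋂ (_ : a ∉ M.hidden) (tr : M.Tr) (_ : tr.1 ∈ A) (_ : tr.1.action ∈ M.hidden) (v')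
        (_ : v' ∈ tr.1.target.support), {f | f (.trA tr) (.stateA v') -
          (tr.1.target v').toReal * f (.stateA tr.1.source) (.trA tr) = 0}) ∩
      (⋂ (_ : a ∉ M.hidden) (tr : M.Tr) (_ : tr.1 ∈ A) (_ : tr.1.action = a) (v')
        (_ : v' ∈ tr.1.target.support), {f | f (.trA tr) (.stateA v') -
          (tr.1.target v').toReal * f (.state tr.1.source) (.trA tr) = 0}) := by
    ext f
    simp only [Set.mem_inter_iff, Set.mem_iInter, Set.mem_ofPred_eq]
    exact ⟨fun ⟨h1, h2, h3, h4, h5, h6, h7⟩ => ⟨⟨⟨⟨⟨⟨h1, h2⟩, h3⟩, h4⟩, h5⟩, h6⟩, h7⟩,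
      fun ⟨⟨⟨⟨⟨⟨h1, h2⟩, h3⟩, h4⟩, h5⟩, h6⟩, h7⟩ => ⟨h1, h2, h3, h4, h5, h6, h7⟩⟩
  rw [h]
  refine IsClosed.inter (IsClosed.inter (IsClosed.inter (IsClosed.inter (IsClosed.inter
    (IsClosed.inter ?_ ?_) ?_) ?_) ?_) ?_) ?_
  · exact isClosed_iInter fun u => isClosed_iInter fun v => isClosed_iInter fun _ =>
      isClosed_le (by fun_prop) (by fun_prop)
  · exact isClosed_eq (by fun_prop) (by fun_prop)
  · exact isClosed_iInter fun C => isClosed_eq (by fun_prop) (by fun_prop)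
  · exact isClosed_iInter fun v => isClosed_iInter fun _ => isClosed_iInter fun _ =>
      isClosed_iInter fun _ => isClosed_eq (by fun_prop) (by fun_prop)
  · exact isClosed_iInter fun tr => isClosed_iInter fun _ => isClosed_iInter fun _ =>
      isClosed_iInter fun v => isClosed_iInter fun _ => isClosed_eq (by fun_prop) (by fun_prop)
  · exact isClosed_iInter fun _ => isClosed_iInter fun tr => isClosed_iInter fun _ =>
      isClosed_iInter fun _ => isClosed_iInter fun v => isClosed_iInter fun _ =>
        isClosed_eq (by fun_prop) (by fun_prop)
  · exact isClosed_iInter fun _ => isClosed_iInter fun tr => isClosed_iInter fun _ =>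
      isClosed_iInter fun _ => isClosed_iInter fun v => isClosed_iInter fun _ =>
        isClosed_eq (by fun_prop) (by fun_prop)

-- Values off the arcs are unconstrained, which would destroy compactness. Setting them to zero is
-- invisible to the constraints and to the objective.
open Classical in
theorem LPFeasible.truncate (h : M.LPFeasible t a μ A R f) :
    M.LPFeasible t a μ A R (fun u v => if M.Arc t a A R u v then f u v else 0) where
  nonneg u v huv := by
    simp only [huv, if_true]
    exact h.nonneg u v huv
  source := by rw [if_pos .source, h.source]
  sink C := by rw [if_pos (.sink C), h.sink]
  conservation v hv h1 h2 := by
    rw [← h.conservation v hv h1 h2]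
    congr 1 <;> exact Finset.sum_congr rfl fun u hu => if_pos (Finset.mem_filter.1 hu).2
  balance tr htr hh v hv := by
    rw [if_pos (.intOut tr v htr hh hv), if_pos (.intIn tr htr hh), h.balance tr htr hh v hv]
  balanceA ha tr htr hh v hv := by
    rw [if_pos (.intOutA tr v ha htr hh hv), if_pos (.intInA tr ha htr hh),
      h.balanceA ha tr htr hh v hv]
  balanceExt ha tr htr hh v hv := by
    rw [if_pos (.extOut tr v ha htr hh hv), if_pos (.extIn tr ha htr hh),
      h.balanceExt ha tr htr hh v hv]

open Classical in
theorem lpObjective_truncate :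
    M.lpObjective t a A R (fun u v => if M.Arc t a A R u v then f u v else 0) =
      M.lpObjective t a A R f :=
  Finset.sum_congr rfl fun _ he => congrArg Neg.neg (if_pos (Finset.mem_filter.1 he).2)

/-- It suffices to maximise over points at least as good as `f`. There the nonnegative arc variables
have bounded sum, so after zeroing the other coordinates these points form a compact set, on which
the continuous objective attains its maximum. -/
theorem LPFeasible.exists_optimal (h : M.LPFeasible t a μ A R f) :
    ∃ g, M.LPOptimal t a μ A R g := by
  classical
  set c := M.lpObjective t a A R f with hc
  let K : Set (M.Vertex R → M.Vertex R → ℝ) := {g | M.LPFeasible t a μ A R g} ∩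
    (⋂ (u) (v) (_ : ¬ M.Arc t a A R u v), {g | g u v = 0}) ∩ {g | c ≤ M.lpObjective t a A R g}
  have hcont : Continuous (M.lpObjective t a A R) := by
    unfold lpObjective
    fun_prop
  have hclosed : IsClosed K := by
    refine IsClosed.inter (IsClosed.inter isClosed_lpFeasible ?_) ?_
    · exact isClosed_iInter fun u => isClosed_iInter fun v => isClosed_iInter fun _ =>
        isClosed_eq (by fun_prop) (by fun_prop)
    · exact isClosed_le continuous_const hcont
  have hmem : ∀ g, M.LPFeasible t a μ A R g → c ≤ M.lpObjective t a A R g →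
      (fun u v => if M.Arc t a A R u v then g u v else 0) ∈ K := by
    intro g hg hcg
    refine ⟨⟨hg.truncate, ?_⟩, ?_⟩
    · simp only [Set.mem_iInter]
      intro u v huv
      exact if_neg huv
    · change c ≤ _
      rwa [lpObjective_truncate]
  have hsub : K ⊆ Set.pi Set.univ fun _ => Set.pi Set.univ fun _ => Set.Icc 0 (-c) := by
    rintro g ⟨⟨hg, hz⟩, hcg⟩ u - v -
    simp only [Set.mem_iInter] at hz
    have hcg : c ≤ M.lpObjective t a A R g := hcg
    have hobj : M.lpObjective t a A R g =
        -∑ e : M.Vertex R × M.Vertex R with M.Arc t a A R e.1 e.2, g e.1 e.2 :=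
      Finset.sum_neg_distrib _
    have hnn : ∀ e ∈ (Finset.univ : Finset (M.Vertex R × M.Vertex R)).filter
        (fun e => M.Arc t a A R e.1 e.2), 0 ≤ g e.1 e.2 := fun e he =>
      hg.nonneg _ _ (Finset.mem_filter.1 he).2
    by_cases huv : M.Arc t a A R u v
    · refine ⟨hg.nonneg u v huv, ?_⟩
      have := Finset.single_le_sum hnn (a := (u, v)) (by simp [huv])
      simp only at this
      linarith
    · have h0 : g u v = 0 := hz u v huv
      have := Finset.sum_nonneg hnn
      rw [h0]
      exact ⟨le_rfl, by linarith⟩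
  have hcomp : IsCompact K :=
    (isCompact_univ_pi fun _ => isCompact_univ_pi fun _ => isCompact_Icc).of_isClosed_subset
      hclosed hsub
  obtain ⟨g, hg, hmax⟩ := hcomp.exists_isMaxOn ⟨_, hmem f h le_rfl⟩ hcont.continuousOn
  refine ⟨g, hg.1.1, fun g' hg' => ?_⟩
  rcases le_or_gt c (M.lpObjective t a A R g') with hle | hlt
  · have := hmax (hmem g' hg' hle)
    simp only [Set.mem_ofPred_eq, lpObjective_truncate] at this
    exact this
  · exact hlt.le.trans hg.2

end Optimal

/-! ### Assembling the equivalences. -/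

section Main

variable {S Act : Type*} {M : ProbAut S Act} {a : Act} {ρ μ : PMF S} {R : Setoid S}

theorem Scheduler.respects_trans (σ : M.Scheduler) : σ.Respects M.trans := fun _ tr _ => tr.2

theorem allowedHyper_trans_iff : M.AllowedHyper M.trans ρ a μ ↔ M.Hyper ρ a μ := by
  have : ∀ (s : S) (ν : PMF S), M.AllowedWeakCombined M.trans s a ν ↔ M.WeakCombined s a ν :=
    fun s ν => ⟨fun ⟨σ, h, _⟩ => ⟨σ, h⟩, fun ⟨σ, h⟩ => ⟨σ, h, σ.respects_trans⟩⟩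
  simp only [AllowedHyper, Hyper, this]

/-- Makes weak transitions the special case of hyper-transitions from a Dirac mass, so that one flow
argument covers both. -/
theorem Scheduler.induces_iff_inducesHyper_pure {σ : M.Scheduler} {t : S} {ν : PMF S} :
    σ.Induces t a ν ↔ σ.InducesHyper (PMF.pure t) a ν := by
  have hsum : ∀ (κ : (PMF.pure t).support → PMF S) (v : S),
      ∑' s : (PMF.pure t).support, PMF.pure t s * κ s v = κ ⟨t, by simp⟩ v := by
    intro κ v
    rw [tsum_eq_single (⟨t, by simp⟩ : (PMF.pure t).support)]
    · simp
    · rintro ⟨s, hs⟩ hne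
      exact absurd (Subtype.ext (by simpa using hs)) hne
  constructor
  · intro h
    refine ⟨fun _ => ν, ?_, fun v => by rw [hsum]⟩
    rintro ⟨s, hs⟩
    obtain rfl : s = t := by simpa using hs
    exact h
  · rintro ⟨κ, hκ, hν⟩
    have : ν = κ ⟨t, by simp⟩ := by
      ext v
      rw [hν, hsum]
    rw [this]
    exact hκ ⟨t, by simp⟩

theorem tfae_lpFeasible {S Act : Type*} [Finite S] {M : ProbAut S Act} {t : S} {a : Act}
    {μ : PMF S} {A : Set (Transition S Act)} {R : Setoid S} :
    [∃ f, M.LPFeasible t a μ A R f,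
      ∃ f, M.LPFeasible t a μ A R f ∧ ∀ C : Quotient R, f (.cls C) .sink = classProb R μ C,
      ∃ f, M.LPOptimal t a μ A R f ∧
        ∀ C : Quotient R, f (.cls C) .sink = classProb R μ C].TFAE := by
  tfae_have 1 → 3 := fun ⟨f, hf⟩ =>
    let ⟨g, hg⟩ := hf.exists_optimal
    ⟨g, hg, hg.1.sink⟩
  tfae_have 3 → 2 := fun ⟨f, hf, h⟩ => ⟨f, hf.1, h⟩
  tfae_have 2 → 1 := fun ⟨f, hf, _⟩ => ⟨f, hf⟩
  tfae_finish

/-- Flows, schedulers and hyper-transitions. -/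
theorem tfae_isFlow [Finite S] {A : Finset (Transition S Act)} (hA : ↑A ⊆ M.trans) :
    [∃ (ν : PMF S) (x : List Act × Transition S Act → ℝ≥0),
        M.IsFlow a A (fun v => (ρ v).toNNReal) (fun v => (ν v).toNNReal) x ∧
        ∀ C, classProb R ν C = classProb R μ C,
      ∃ (ν : PMF S) (σ : M.Scheduler),
        σ.InducesHyper ρ a ν ∧ σ.Respects A ∧ Lifting R.r ν μ,
      ∃ ν : PMF S, M.AllowedHyper A ρ a ν ∧ Lifting R.r ν μ].TFAE := by
  tfae_have 1 → 2 := fun ⟨ν, x, hx, hC⟩ =>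
    let ⟨σ, h1, h2⟩ := hx.exists_scheduler hA
    ⟨ν, σ, h1, h2, (lifting_setoid_iff R ν μ).2 hC⟩
  tfae_have 2 → 3 := fun ⟨ν, σ, ⟨κ, hκ, hν⟩, h2, h3⟩ =>
    ⟨ν, ⟨κ, fun s => ⟨σ, hκ s, h2⟩, hν⟩, h3⟩
  tfae_have 3 → 1 := fun ⟨ν, h, hL⟩ =>
    let ⟨x, hx⟩ := h.exists_isFlow
    ⟨ν, x, hx, (lifting_setoid_iff R ν μ).1 hL⟩
  tfae_finish

theorem tfae_allowedHyper [Finite S] {A : Set (Transition S Act)} (hA : A ⊆ M.trans) {τ : Act}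
    (hτ : τ ∈ M.hidden) :
    [∃ f, (M.extend τ ρ).LPFeasible none a (extDist μ) (extTrans A τ ρ) (extSetoid R) f ∧
        ∀ C : Quotient (extSetoid R), f (.cls C) .sink = classProb (extSetoid R) (extDist μ) C,
      ∃ f, (M.extend τ ρ).LPOptimal none a (extDist μ) (extTrans A τ ρ) (extSetoid R) f ∧
        ∀ C : Quotient (extSetoid R), f (.cls C) .sink = classProb (extSetoid R) (extDist μ) C,
      ∃ (ν : PMF S) (σ : M.Scheduler),
        σ.InducesHyper ρ a ν ∧ σ.Respects A ∧ Lifting R.r ν μ,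
      ∃ ν : PMF S, M.AllowedHyper A ρ a ν ∧ Lifting R.r ν μ].TFAE := by
  lift A to Finset (Transition S Act) using M.finite_trans.subset hA
  have hsub : (extFinset A τ ρ : Set (Transition (Option S) Act)) ⊆ (M.extend τ ρ).trans := by
    rw [coe_extFinset]
    exact Set.union_subset_union_left _ (Set.image_mono hA)
  have h1 := exists_lpFeasible_iff (t := none) (a := a) (μ := extDist μ) (R := extSetoid R) hsub
  rw [exists_isFlow_extend_iff hτ, coe_extFinset] at h1
  have h2 := tfae_lpFeasible (M := M.extend τ ρ) (t := none) (a := a) (μ := extDist μ)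
    (A := extTrans A τ ρ) (R := extSetoid R)
  have h3 := tfae_isFlow (a := a) (ρ := ρ) (μ := μ) (R := R) hA
  tfae_have 1 ↔ 2 := h2.out 1 2
  tfae_have 1 ↔ 3 := (h2.out 1 0).trans (h1.trans (h3.out 0 1))
  tfae_have 3 ↔ 4 := h3.out 1 2
  tfae_finish

theorem tfae_weakCombined [Finite S] {t : S} :
    [∃ f, M.LPFeasible t a μ M.trans R f ∧
        ∀ C : Quotient R, f (.cls C) .sink = classProb R μ C,
      ∃ f, M.LPOptimal t a μ M.trans R f ∧
        ∀ C : Quotient R, f (.cls C) .sink = classProb R μ C,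
      ∃ (ν : PMF S) (σ : M.Scheduler), σ.Induces t a ν ∧ Lifting R.r μ ν].TFAE := by
  obtain ⟨A, hA⟩ : ∃ A : Finset (Transition S Act), ↑A = M.trans := M.finite_trans.exists_finset_coe
  have h1 := exists_lpFeasible_iff (t := t) (a := a) (μ := μ) (R := R) hA.le
  have h2 := tfae_lpFeasible (M := M) (t := t) (a := a) (μ := μ) (A := M.trans) (R := R)
  have h3 := tfae_isFlow (a := a) (ρ := PMF.pure t) (μ := μ) (R := R) hA.le
  -- The two sides of the lifting are swapped here compared with `tfae_isFlow`; the criterion by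
  -- class probabilities is symmetric.
  have hL : ∀ ν, Lifting R.r μ ν ↔ Lifting R.r ν μ := fun ν => by
    simp only [lifting_setoid_iff, eq_comm]
  simp only [hA, Scheduler.respects_trans, true_and, ← Scheduler.induces_iff_inducesHyper_pure,
    ← hL] at h1 h3
  tfae_have 1 ↔ 2 := h2.out 1 2
  tfae_have 1 ↔ 3 := (h2.out 1 0).trans (h1.trans (h3.out 0 1))
  tfae_finish

end Main

end ProbAut

end

theorem mainTheorem4 {S Act : Type*} [Finite S] (M : ProbAut S Act) (t : S) (a : Act)
    (ρ μ : PMF S) (A : Set (Transition S Act)) (hA : A ⊆ M.trans) (R : Setoid S) :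
    -- ordinary weak combined transitions
    [∃ f, M.LPFeasible t a μ M.trans R f ∧
        ∀ C : Quotient R, f (.cls C) .sink = classProb R μ C,
      ∃ f, M.LPOptimal t a μ M.trans R f ∧
        ∀ C : Quotient R, f (.cls C) .sink = classProb R μ C,
      ∃ (μt : PMF S) (σ : M.Scheduler), σ.Induces t a μt ∧ Lifting R.r μ μt].TFAE ∧
    -- allowed hyper-transitions
    (∀ τ ∈ M.hidden,
      [∃ f, (M.extend τ ρ).LPFeasible none a (extDist μ) (extTrans A τ ρ) (extSetoid R) f ∧
          ∀ C : Quotient (extSetoid R), f (.cls C) .sink = classProb (extSetoid R) (extDist μ) C,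
        ∃ f, (M.extend τ ρ).LPOptimal none a (extDist μ) (extTrans A τ ρ) (extSetoid R) f ∧
          ∀ C : Quotient (extSetoid R), f (.cls C) .sink = classProb (extSetoid R) (extDist μ) C,
        ∃ (μt : PMF S) (σ : M.Scheduler),
          σ.InducesHyper ρ a μt ∧ σ.Respects A ∧ Lifting R.r μt μ,
        ∃ μt : PMF S, M.AllowedHyper A ρ a μt ∧ Lifting R.r μt μ].TFAE) ∧
    -- ordinary hyper-transitions
    (∀ τ ∈ M.hidden,
      [∃ f, (M.extend τ ρ).LPFeasible none a (extDist μ) (M.extend τ ρ).trans (extSetoid R) f ∧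
          ∀ C : Quotient (extSetoid R), f (.cls C) .sink = classProb (extSetoid R) (extDist μ) C,
        ∃ f, (M.extend τ ρ).LPOptimal none a (extDist μ) (M.extend τ ρ).trans (extSetoid R) f ∧
          ∀ C : Quotient (extSetoid R), f (.cls C) .sink = classProb (extSetoid R) (extDist μ) C,
        ∃ (μt : PMF S) (σ : M.Scheduler), σ.InducesHyper ρ a μt ∧ Lifting R.r μt μ,
        ∃ μt : PMF S, M.Hyper ρ a μt ∧ Lifting R.r μt μ].TFAE) ∧
    -- lifting of the identity relation
    (∀ μt : PMF S, Lifting (fun x y : S => x = y) μ μt → μt = μ) := by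
  refine ⟨ProbAut.tfae_weakCombined, fun τ hτ => ProbAut.tfae_allowedHyper hA hτ,
    fun τ hτ => ?_, fun μt => eq_of_lifting_eq⟩
  -- The ordinary case is that of all transitions being allowed: `extTrans M.trans τ ρ` is by
  -- definition the transition set of the extended automaton.
  have h := ProbAut.tfae_allowedHyper (a := a) (ρ := ρ) (μ := μ) (R := R) subset_rfl hτ
  simp only [ProbAut.Scheduler.respects_trans, true_and, ProbAut.allowedHyper_trans_iff] at h
  exact h
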